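/- Let $d\ge 2$, $1\le k\le d-1$ and $s\in\mathbb R$. Let $G_{k,d}$ be the Grassmannian of $k$-dimensional linear subspaces of $\mathbb R^d$ with its $O(d)$-invariant measure $d\alpha$ of total mass $|G_{k,d}|=\prod_{j=0}^{k-1}|\mathbb S^{d-1-j}|\big/\prod_{j=0}^{k-1}|\mathbb S^{j}|$ (where $|\mathbb S^0|=2$), and let $\mathcal G_{k,d}=\{(\alpha,y):\alpha\in G_{k,d},\ y\in\alpha^\perp\}$ be the affine Grassmannian. All Fourier transforms are unitary, $\hat\varphi(\xi)=(2\pi)^{-n/2}\int_{\mathbb R^n}e^{-ix\cdot\xi}\varphi(x)\,dx$. For a tempered distribution $f$ on $\mathbb R^d$ put $$\|f\|_{H^s(\mathbb R^d)}^2=\int_{\mathbb R^d}(1+|\xi|^2)^s|\hat f(\xi)|^2\,d\xi .$$ For a family $u=(u(\alpha,\cdot))_{\alpha\in G_{k,d}}$ of tempered distributions $u(\alpha,\cdot)$ on $\alpha^\perp$ put $$\|u\|_{H^r(\mathcal G_{k,d})}^2=\int_{G_{k,d}}\int_{\alpha^\perp}(1+|\eta|^2)^r|\hat u(\alpha,\eta)|^2\,d\eta\,d\alpha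 ,$$ where $\hat u(\alpha,\cdot)$ is the Fourier transform of $u(\alpha,\cdot)$ on $\alpha^\perp$; $u\in H^r(\mathcal G_{k,d})$ means that $\hat u$ is a measurable function on $\mathcal G_{k,d}$ and this norm is finite. The $k$-plane transform of a test function $f$ is $(Pf)(\alpha,y)=\int_\alpha f(x+y)\,dx$; for a compactly supported distribution $f$ on $\mathbb R^d$, $Pf$ is defined by transposition, $\langle Pf(\alpha,\cdot),\varphi\rangle=\langle f,\varphi\circ\pi_{\alpha^\perp}\rangle$ for $\varphi\in\mathcal S(\alpha^\perp)$, with $\pi_{\alpha^\perp}$ the orthogonal projection onto $\alpha^\perp$. **Theorem.** There is a constant $c=c_{s,d,k}>0$ such that for every bounded open set $\Omega\subset\mathbb R^d$ there is a constant $C=C_{s,d,k,\Omega}>0$ such that every $f\in H^s(\mathbb R^d)$ with $\operatorname{supp} f\subseteq\overline\Omega$ satisfies $Pf\in H^{s+k/2}(\mathcal G_{k,d})$ and $$c\,\|f\|_{H^s(\mathbb R^d)}\le\|Pf\|_{H^{s+k/2}(\mathcal G_{k,d})}\le C\,\|f\|_{H^s(\mathbb R^d)} .$$ -/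

import Mathlib

open MeasureTheory
open scoped SchwartzMap ENNReal ContDiff

noncomputable section

namespace KPlane

/-- Euclidean space `ℝ^d`. -/
abbrev Euc (d : ℕ) := EuclideanSpace ℝ (Fin d)

/-! ### The unitary Fourier transform and Sobolev norms on a Euclidean space -/

section Fourier

variable {V : Type*} [NormedAddCommGroup V] [InnerProductSpace ℝ V] [FiniteDimensional ℝ V]
  [MeasurableSpace V] [BorelSpace V]

/-- The normalizing factor `(2π)^(-n/2)`, `n = dim V`. -/
def fourierConst (V : Type*) [NormedAddCommGroup V] [InnerProductSpace ℝ V] : ℝ :=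
  (2 * Real.pi) ^ (-(Module.finrank ℝ V : ℝ) / 2)

/-- The unitary Fourier transform on Schwartz functions, obtained from Mathlib's one (with phase
`-2πi⟪x, ξ⟫`) by a dilation and a normalization. See `fourierSchwartz_apply` for the formula
`φ̂(ξ) = (2π)^(-n/2) ∫ e^{-i⟪x, ξ⟫} φ(x) dx`. -/
def fourierSchwartz (V : Type*) [NormedAddCommGroup V] [InnerProductSpace ℝ V]
    [FiniteDimensional ℝ V] [MeasurableSpace V] [BorelSpace V] : 𝓢(V, ℂ) →L[ℂ] 𝓢(V, ℂ) :=
  (fourierConst V : ℂ) •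
    ((SchwartzMap.compCLMOfContinuousLinearEquiv ℂ
      (ContinuousLinearEquiv.smulLeft (Units.mk0 ((2 * Real.pi)⁻¹ : ℝ) (by positivity)) :
        V ≃L[ℝ] V)) ∘L
      (FourierTransform.fourierCLM ℂ 𝓢(V, ℂ)))

theorem fourierSchwartz_apply (φ : 𝓢(V, ℂ)) (ξ : V) :
    fourierSchwartz V φ ξ =
      (fourierConst V : ℂ) * ∫ x : V, Complex.exp (-(inner ℝ x ξ : ℝ) * Complex.I) * φ x := by
  have h : (fourierSchwartz V φ) ξ =
      (fourierConst V : ℂ) * (FourierTransform.fourier φ : 𝓢(V, ℂ)) ((2 * Real.pi)⁻¹ • ξ) := rfl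
  rw [h, SchwartzMap.fourier_coe, Real.fourier_eq']
  congr 2
  ext x
  rw [smul_eq_mul, inner_smul_right]
  congr 3
  have : (Real.pi : ℂ) ≠ 0 := by exact_mod_cast Real.pi_ne_zero
  push_cast
  field_simp

/-- The unitary Fourier transform of a tempered distribution: `⟨û, φ⟩ = ⟨u, φ̂⟩`. -/
def fourierDist (u : 𝓢'(V, ℂ)) : 𝓢'(V, ℂ) :=
  PointwiseConvergenceCLM.precomp ℂ (fourierSchwartz V) u

/-- The tempered distribution `u` is given by integration against the function `w`. -/
def IsGivenBy (u : 𝓢'(V, ℂ)) (w : V → ℂ) : Prop :=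
  AEStronglyMeasurable w ∧
    ∀ φ : 𝓢(V, ℂ), Integrable (fun x => φ x * w x) ∧ u φ = ∫ x, φ x * w x

/-- `∫ (1 + |ξ|²)^s |w(ξ)|² dξ`. -/
def energy (s : ℝ) (w : V → ℂ) : ℝ≥0∞ :=
  ∫⁻ ξ, ENNReal.ofReal ((1 + ‖ξ‖ ^ 2) ^ s) * ‖w ξ‖ₑ ^ 2

/-- The Sobolev norm `(∫ (1 + |ξ|²)^s |û(ξ)|² dξ)^(1/2)`; it is `∞` if `û` is not a function.
(The function that represents `û` is unique almost everywhere, so that the infimum is over a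
constant family.) -/
def sobolevNorm (s : ℝ) (u : 𝓢'(V, ℂ)) : ℝ≥0∞ :=
  ⨅ (w : V → ℂ) (_ : IsGivenBy (fourierDist u) w), energy s w ^ (1 / 2 : ℝ)

end Fourier

/-! ### The Grassmannian and its invariant measure -/

/-- The Grassmannian `G_{k,d}` of `k`-dimensional linear subspaces of `ℝ^d`. -/
structure Grassmannian (k d : ℕ) where
  /-- The subspace. -/
  space : Submodule ℝ (Euc d)
  finrank_eq : Module.finrank ℝ space = k

variable {k d : ℕ}

/-- The orthogonal projection onto `α`, as an operator on `ℝ^d`. -/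
def Grassmannian.proj (α : Grassmannian k d) : Euc d →L[ℝ] Euc d := α.space.starProjection

/-- The usual topology of the Grassmannian: the distance of two subspaces is the operator norm of
the difference of the orthogonal projections. -/
instance : TopologicalSpace (Grassmannian k d) :=
  TopologicalSpace.induced Grassmannian.proj inferInstance

instance : MeasurableSpace (Grassmannian k d) := borel _

instance : BorelSpace (Grassmannian k d) := ⟨rfl⟩

/-- The orthogonal group `O(d)`. -/
abbrev OrthGroup (d : ℕ) := Matrix.orthogonalGroup (Fin d) ℝ

instance (d : ℕ) : MeasurableSpace (OrthGroup d) := borel _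

instance (d : ℕ) : BorelSpace (OrthGroup d) := ⟨rfl⟩

instance (d : ℕ) : CompactSpace (OrthGroup d) := by
  suffices key : IsCompact ((OrthGroup d : Submonoid (Matrix (Fin d) (Fin d) ℝ)) :
      Set (Matrix (Fin d) (Fin d) ℝ)) from
    isCompact_iff_compactSpace.1 key
  have hc : IsCompact {A : Matrix (Fin d) (Fin d) ℝ | ∀ i j, A i j ∈ Set.Icc (-1 : ℝ) 1} := by
    have := isCompact_univ_pi (X := fun _ : Fin d => Fin d → ℝ)
      (s := fun _ => {v | ∀ j, v j ∈ Set.Icc (-1 : ℝ) 1}) (fun _ => by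
        have := isCompact_univ_pi (X := fun _ : Fin d => ℝ)
          (s := fun _ => Set.Icc (-1 : ℝ) 1) (fun _ => isCompact_Icc)
        simpa [Set.pi] using this)
    simp only [Set.pi, Set.mem_univ, forall_const, Set.mem_ofPred_eq] at this
    exact this
  refine hc.of_isClosed_subset ?_ ?_
  · have : ((OrthGroup d : Submonoid (Matrix (Fin d) (Fin d) ℝ)) : Set _) =
        {A : Matrix (Fin d) (Fin d) ℝ | A * star A = 1} := by
      ext A
      exact Matrix.mem_orthogonalGroup_iff (Fin d) ℝ
    rw [this]
    exact isClosed_eq (by fun_prop) continuous_const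
  · intro A hA i j
    have := entry_norm_bound_of_unitary (𝕜 := ℝ) hA i j
    rwa [Real.norm_eq_abs, abs_le] at this

/-- The Haar probability measure of `O(d)`. -/
def orthHaar (d : ℕ) : Measure (OrthGroup d) :=
  Measure.haarMeasure ⟨⟨Set.univ, isCompact_univ⟩, by simp⟩

instance (d : ℕ) : IsProbabilityMeasure (orthHaar d) :=
  ⟨Measure.haarMeasure_self (K₀ := ⟨⟨Set.univ, isCompact_univ⟩, by simp⟩)⟩

/-- The `j`-th column `g e_j` of an orthogonal matrix `g`. -/
def col (g : OrthGroup d) (j : Fin d) : Euc d := WithLp.toLp 2 (fun i => g.1 i j)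

theorem orthonormal_col (g : OrthGroup d) : Orthonormal ℝ (col g) := by
  rw [orthonormal_iff_ite]
  intro i j
  have h := (Matrix.mem_orthogonalGroup_iff' (Fin d) ℝ).1 g.2
  have h' := congrFun (congrFun h i) j
  rw [Matrix.mul_apply, Matrix.one_apply] at h'
  rw [← h']
  simp [col, PiLp.inner_apply, mul_comm]

/-- The subspace `g α₀`, where `α₀` is the span of the first `k` standard basis vectors. -/
def rotated (hk : k ≤ d) (g : OrthGroup d) : Grassmannian k d :=
  ⟨Submodule.span ℝ (Set.range fun i : Fin k => col g (Fin.castLE hk i)), by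
    rw [finrank_span_eq_card]
    · simp
    · exact ((orthonormal_col g).comp _ (Fin.castLE_injective hk)).linearIndependent⟩

theorem proj_rotated (hk : k ≤ d) (g : OrthGroup d) :
    (rotated hk g).proj = ∑ i : Fin k,
      (innerSL ℝ (col g (Fin.castLE hk i))).smulRight (col g (Fin.castLE hk i)) := by
  have ho := (orthonormal_col g).comp _ (Fin.castLE_injective hk)
  ext1 x
  refine Submodule.eq_starProjection_of_mem_of_inner_eq_zero (K := (rotated hk g).space) (u := x)
    ?_ ?_
  · simp only [sum_apply, ContinuousLinearMap.smulRight_apply]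
    exact Submodule.sum_mem _ fun i _ => Submodule.smul_mem _ _ (Submodule.subset_span ⟨i, rfl⟩)
  · intro w hw
    induction hw using Submodule.span_induction with
    | mem w hw =>
      obtain ⟨i, rfl⟩ := hw
      have h := ho.inner_left_fintype (fun j => inner ℝ (col g (Fin.castLE hk j)) x) i
      simp only [Function.comp_def, conj_trivial] at h
      simp only [sum_apply, ContinuousLinearMap.smulRight_apply,
        innerSL_apply_apply, inner_sub_left, h]
      rw [real_inner_comm, sub_self]
    | zero => simp
    | add a b _ _ ha hb => rw [inner_add_right, ha, hb, add_zero]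
    | smul c a _ ha => rw [inner_smul_right, ha, mul_zero]

theorem continuous_rotated (hk : k ≤ d) : Continuous (rotated (d := d) hk) := by
  rw [continuous_induced_rng]
  have hc : ∀ j, Continuous fun g : OrthGroup d => col g j := fun j => by
    unfold col
    refine (PiLp.continuous_toLp 2 _).comp (continuous_pi fun i => ?_)
    exact (continuous_apply_apply i j).comp continuous_subtype_val
  have : (Grassmannian.proj ∘ rotated (d := d) hk) = fun g => ∑ i : Fin k,
      (innerSL ℝ (col g (Fin.castLE hk i))).smulRight (col g (Fin.castLE hk i)) :=
    funext fun g => proj_rotated hk g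
  rw [this]
  have hs : Continuous fun v : Euc d => (innerSL ℝ v).smulRight v := by
    have : Continuous fun p : (Euc d →L[ℝ] ℝ) × Euc d => p.1.smulRight p.2 := by
      fun_prop
    exact this.comp (((innerSL ℝ).continuous).prodMk continuous_id)
  exact continuous_finsetSum _ fun i _ => hs.comp (hc _)

/-- The surface area `|S^n|` of the unit sphere of `ℝ^(n+1)`. -/
def sphereArea (n : ℕ) : ℝ≥0∞ := (volume : Measure (Euc (n + 1))).toSphere Set.univ

/-- The total measure `|G_{k,d}| = (|S^{d-1}| ⋯ |S^{d-k}|) / (|S^{k-1}| ⋯ |S^1| |S^0|)` of the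
Grassmannian (`|S^0| = 2`); it equals `1` for `k = 0` and `|S^{d-1}| / 2` for `k = 1`. -/
def grassmannianMass (k d : ℕ) : ℝ≥0∞ :=
  (∏ j ∈ Finset.range k, sphereArea (d - 1 - j)) / ∏ j ∈ Finset.range k, sphereArea j

/-- The `O(d)`-invariant measure `dα` on `G_{k,d}` with total measure `|G_{k,d}|`: a multiple of the
image of the Haar measure of `O(d)` under `g ↦ g α₀`. (The Grassmannian is empty for `d < k`.) -/
def grassmannianMeasure (k d : ℕ) : Measure (Grassmannian k d) :=
  if hk : k ≤ d then grassmannianMass k d • (orthHaar d).map (rotated hk) else 0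

/-! ### The affine Grassmannian and Sobolev norms on it -/

/-- The affine Grassmannian: pairs `(α, y)` with `y ∈ αᗮ`, representing the plane `α + y`. -/
structure AffineGrassmannian (k d : ℕ) where
  /-- The direction `α`. -/
  dir : Grassmannian k d
  /-- The point `y ∈ αᗮ`. -/
  pt : dir.spaceᗮ

/-- The Borel structure of `{(α, y) : y ∈ αᗮ}` as a subset of `G_{k,d} × ℝ^d`. -/
instance : MeasurableSpace (AffineGrassmannian k d) :=
  MeasurableSpace.comap (fun p => (p.dir, (p.pt : Euc d))) inferInstance

/-- A family `α ↦ u_α = u(α, ·)` of tempered distributions in the fiber variable `y ∈ αᗮ`. -/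
abbrev FiberDistribution (k d : ℕ) := ∀ α : Grassmannian k d, 𝓢'(α.spaceᗮ, ℂ)

/-- The fiberwise Fourier transform `û(α, η)` of `u` is the measurable function `w` on the affine
Grassmannian. -/
def HasFiberFourier (u : FiberDistribution k d) (w : AffineGrassmannian k d → ℂ) : Prop :=
  Measurable w ∧ ∀ᵐ α ∂(grassmannianMeasure k d),
    IsGivenBy (fourierDist (u α)) (fun η => w ⟨α, η⟩)

/-- The Sobolev norm `(∫_{G_{k,d}} ∫_{αᗮ} (1 + |η|²)^s |û(α, η)|² dη dα)^(1/2)` on the affine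
Grassmannian; it is `∞` if `û` is not a measurable function. -/
def sobolevNormG (s : ℝ) (u : FiberDistribution k d) : ℝ≥0∞ :=
  ⨅ (w : AffineGrassmannian k d → ℂ) (_ : HasFiberFourier u w),
    (∫⁻ α, energy s (fun η : α.spaceᗮ => w ⟨α, η⟩) ∂(grassmannianMeasure k d)) ^ (1 / 2 : ℝ)

/-- `u ∈ H^s` on the affine Grassmannian: `û` is a measurable function that is square integrable
with the weight `(1 + |η|²)^s`. -/
def MemSobolevG (s : ℝ) (u : FiberDistribution k d) : Prop := sobolevNormG s u < ⊤

/-! ### The `k`-plane transform -/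

/-- The `k`-plane transform `(Pf)(α, y) = ∫_α f(x + y) dx` of a function. -/
def planeTransform (f : Euc d → ℂ) (α : Grassmannian k d) (y : α.spaceᗮ) : ℂ :=
  ∫ x : α.space, f ((x : Euc d) + (y : Euc d))

section Pushforward

variable {V W : Type*} [NormedAddCommGroup V] [NormedSpace ℝ V] [NormedAddCommGroup W]
  [NormedSpace ℝ W]

/-- For a Schwartz function `χ` and a linear map `L : V → W`, the operator `φ ↦ χ · (φ ∘ L)`. -/
def cutoffComp (χ : 𝓢(V, ℂ)) (L : V →L[ℝ] W) : 𝓢(W, ℂ) →L[ℂ] 𝓢(V, ℂ) :=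
  SchwartzMap.mkCLM (fun φ x => χ x * φ (L x))
    (fun φ ψ x => by simp [mul_add]) (fun a φ x => by simp; ring)
    (fun φ => (χ.smooth ⊤).mul ((φ.smooth ⊤).comp L.contDiff)) (by
      rintro ⟨l, n⟩
      refine ⟨(Finset.range (n + 1)).image fun i => (0, i),
        ∑ i ∈ Finset.range (n + 1), (n.choose i : ℝ) * SchwartzMap.seminorm ℂ l i χ *
          ‖L‖ ^ (n - i), by positivity, fun φ x => ?_⟩
      have h1 := norm_iteratedFDeriv_mul_le (𝕜 := ℝ) (n := n) (N := ∞)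
        (χ.smooth ⊤) ((φ.smooth ⊤).comp L.contDiff) x (mod_cast le_top)
      refine (mul_le_mul_of_nonneg_left h1 (by positivity)).trans ?_
      rw [Finset.mul_sum, Finset.sum_mul]
      refine Finset.sum_le_sum fun i hi => ?_
      have h2 : ‖x‖ ^ l * ‖iteratedFDeriv ℝ i χ x‖ ≤ SchwartzMap.seminorm ℂ l i χ :=
        SchwartzMap.le_seminorm ℂ l i χ x
      have h3 : ‖iteratedFDeriv ℝ (n - i) (fun x => φ (L x)) x‖ ≤
          ‖L‖ ^ (n - i) * SchwartzMap.seminorm ℂ 0 (n - i) φ := by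
        have h4 : ‖iteratedFDeriv ℝ (n - i) (φ ∘ L) x‖ ≤
            ‖iteratedFDeriv ℝ (n - i) φ (L x)‖ * ‖L‖ ^ (n - i) := by
          have hle : ∀ m : ℕ, (m : WithTop ℕ∞) ≤ ((⊤ : ℕ∞) : WithTop ℕ∞) := fun m =>
            mod_cast (le_top : (m : ℕ∞) ≤ ⊤)
          rw [L.iteratedFDeriv_comp_right (φ.smooth ⊤) x (hle _)]
          refine (ContinuousMultilinearMap.norm_compContinuousLinearMap_le _ _).trans_eq ?_
          simp
        have h5 := SchwartzMap.le_seminorm ℂ 0 (n - i) φ (L x)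
        rw [pow_zero, one_mul] at h5
        calc _ ≤ _ := h4
          _ ≤ _ := by rw [mul_comm]; gcongr
      have h6 : SchwartzMap.seminorm ℂ 0 (n - i) φ ≤
          ((Finset.range (n + 1)).image fun i => (0, i)).sup
            (schwartzSeminormFamily ℂ W ℂ) φ := by
        have : (0, n - i) ∈ (Finset.range (n + 1)).image fun i => ((0 : ℕ), i) :=
          Finset.mem_image.2 ⟨n - i, by simp, rfl⟩
        exact Seminorm.le_def.1 (Finset.le_sup (f := schwartzSeminormFamily ℂ W ℂ) this) φ
      calc ‖x‖ ^ l * ((n.choose i : ℝ) * ‖iteratedFDeriv ℝ i χ x‖ *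
            ‖iteratedFDeriv ℝ (n - i) (fun x => φ (L x)) x‖)
          = (n.choose i : ℝ) * (‖x‖ ^ l * ‖iteratedFDeriv ℝ i χ x‖) *
            ‖iteratedFDeriv ℝ (n - i) (fun x => φ (L x)) x‖ := by ring
        _ ≤ (n.choose i : ℝ) * SchwartzMap.seminorm ℂ l i χ *
            (‖L‖ ^ (n - i) * SchwartzMap.seminorm ℂ 0 (n - i) φ) := by gcongr
        _ ≤ (n.choose i : ℝ) * SchwartzMap.seminorm ℂ l i χ *
            (‖L‖ ^ (n - i) * _) := by gcongr
        _ = _ := (mul_assoc _ _ _).symm)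

@[simp]
theorem cutoffComp_apply (χ : 𝓢(V, ℂ)) (L : V →L[ℝ] W) (φ : 𝓢(W, ℂ)) (x : V) :
    cutoffComp χ L φ x = χ x * φ (L x) := rfl

/-- `χ` is a smooth compactly supported cutoff function, equal to `1` near the support of `f`. -/
def IsCutoff (f : 𝓢'(V, ℂ)) (χ : 𝓢(V, ℂ)) : Prop :=
  HasCompactSupport χ ∧ ∃ U : Set V, IsOpen U ∧ Distribution.dsupport f ⊆ U ∧ ∀ x ∈ U, χ x = 1

open Classical in
/-- The image of a compactly supported distribution `f` under a linear map `L`: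
`⟨L_* f, φ⟩ = ⟨f, φ ∘ L⟩`, which means `⟨f, χ · (φ ∘ L)⟩` for any cutoff function `χ` that is `1`
near the support of `f`, see `pushforward_eq`. (Junk value `0` if the support is not compact.) -/
def pushforward (f : 𝓢'(V, ℂ)) (L : V →L[ℝ] W) : 𝓢'(W, ℂ) :=
  if h : ∃ χ, IsCutoff f χ then PointwiseConvergenceCLM.precomp ℂ (cutoffComp h.choose L) f else 0

/-- Smooth cutoff functions exist. -/
theorem exists_cutoff [FiniteDimensional ℝ V] {K O : Set V} (hK : IsCompact K) (hO : IsOpen O)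
    (hKO : K ⊆ O) : ∃ χ : 𝓢(V, ℂ), HasCompactSupport χ ∧ tsupport χ ⊆ O ∧
      ∃ U : Set V, IsOpen U ∧ K ⊆ U ∧ ∀ x ∈ U, χ x = 1 := by
  obtain ⟨K', hK', h1, h2⟩ := exists_compact_between hK hO hKO
  obtain ⟨g, hg1, hg0, -⟩ := exists_contMDiffMap_one_nhds_of_subset_interior
    (n := ⊤) (modelWithCornersSelf ℝ V) hK.isClosed h1
  have hts : tsupport (fun x => (g x : ℂ)) ⊆ K' := by
    refine closure_minimal (fun x hx => ?_) hK'.isClosed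
    by_contra h
    exact hx (by simp [hg0 x h])
  have hcs : HasCompactSupport (fun x => (g x : ℂ)) :=
    HasCompactSupport.of_support_subset_isCompact hK' ((subset_tsupport _).trans hts)
  have hsm : ContDiff ℝ ∞ (fun x => (g x : ℂ)) :=
    Complex.ofRealCLM.contDiff.comp g.contMDiff.contDiff
  obtain ⟨U, hU, hKU, hU1⟩ := Filter.eventually_iff_exists_mem.1 hg1 |>.elim
    fun W hW => (mem_nhdsSet_iff_exists.1 hW.1).elim fun U hU => 
      (⟨U, hU.1, hU.2.1, fun x hx => hW.2 x (hU.2.2 hx)⟩ :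
        ∃ U : Set V, IsOpen U ∧ K ⊆ U ∧ ∀ x ∈ U, g x = 1)
  exact ⟨hcs.toSchwartzMap hsm, hcs, hts.trans h2, U, hU, hKU, fun x hx => by
    simp [hU1 x hx]⟩

theorem exists_isCutoff [FiniteDimensional ℝ V] {f : 𝓢'(V, ℂ)}
    (hf : IsCompact (Distribution.dsupport f)) : ∃ χ, IsCutoff f χ :=
  let ⟨χ, h1, _, h2⟩ := exists_cutoff hf isOpen_univ (Set.subset_univ _)
  ⟨χ, h1, h2⟩

/-- A distribution vanishes on compactly supported test functions whose support is disjoint from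
its support. -/
theorem apply_eq_zero [FiniteDimensional ℝ V] (f : 𝓢'(V, ℂ)) (u : 𝓢(V, ℂ))
    (hu : HasCompactSupport u) (h : Disjoint (tsupport u) (Distribution.dsupport f)) :
    f u = 0 := by
  let p : Set V → Prop := fun S => ∃ U : Set V, IsOpen U ∧ S ⊆ U ∧
    ∀ v : 𝓢(V, ℂ), HasCompactSupport v → tsupport v ⊆ U → f v = 0
  have key : p (tsupport u) := by
    refine hu.induction_on (p := p) ?_ ?_ ?_ ?_
    · refine ⟨∅, isOpen_empty, le_rfl, fun v _ hv => ?_⟩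
      have : v = 0 := by
        ext x
        exact image_eq_zero_of_notMem_tsupport fun hx => hv hx
      rw [this, map_zero]
    · rintro S T hST ⟨U, hU, hTU, h⟩
      exact ⟨U, hU, hST.trans hTU, h⟩
    · rintro S T ⟨U₁, hU₁, hS, h₁⟩ ⟨U₂, hU₂, hT, h₂⟩
      refine ⟨U₁ ∪ U₂, hU₁.union hU₂, Set.union_subset_union hS hT, fun v hv hvU => ?_⟩
      have hK : IsCompact (tsupport v \ U₂) := IsCompact.diff hv hU₂
      obtain ⟨χ, hχ, hχU, W, hW, hKW, hW1⟩ := exists_cutoff hK hU₁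
        (fun x hx => (hvU hx.1).resolve_right hx.2)
      let a : 𝓢(V, ℂ) := cutoffComp χ (ContinuousLinearMap.id ℝ V) v
      have ha : ∀ x, a x = χ x * v x := fun x => rfl
      have hac : tsupport a ⊆ tsupport χ := closure_mono fun x hx hx' => hx (by simp [ha, hx'])
      have hbs : Function.support (v - a) ⊆ tsupport v ∩ Wᶜ := by
        intro x hx
        refine ⟨subset_tsupport _ fun hx' => hx (by simp [ha, hx']), fun hxW => hx ?_⟩
        simp [ha, hW1 x hxW]
      have hbt : tsupport (v - a) ⊆ tsupport v ∩ Wᶜ :=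
        closure_minimal hbs ((isClosed_tsupport _).inter hW.isClosed_compl)
      have h₁' : f a = 0 := h₁ a (HasCompactSupport.of_support_subset_isCompact hχ
        ((subset_tsupport _).trans hac)) (hac.trans hχU)
      have h₂' : f (v - a) = 0 := h₂ (v - a) (HasCompactSupport.of_support_subset_isCompact hv
        (hbs.trans Set.inter_subset_left)) fun x hx => by
          by_contra hx2
          exact (hbt hx).2 (hKW ⟨(hbt hx).1, hx2⟩)
      rw [map_sub, h₁', sub_zero] at h₂'
      exact h₂'
    · intro x hx
      obtain ⟨U, hU, hUo, hxU⟩ :=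
        (Distribution.notMem_dsupport_iff x).1 (Set.disjoint_left.1 h hx)
      exact ⟨U, mem_nhdsWithin_of_mem_nhds (hUo.mem_nhds hxU), U, hUo, le_rfl,
        fun v _ hv => hU v hv⟩
  obtain ⟨U, -, hU, h⟩ := key
  exact h u hu hU

/-- The image `L_* f` does not depend on the choice of the cutoff. -/
theorem pushforward_eq [FiniteDimensional ℝ V] {f : 𝓢'(V, ℂ)} {χ : 𝓢(V, ℂ)} (hχ : IsCutoff f χ)
    (L : V →L[ℝ] W) (φ : 𝓢(W, ℂ)) : pushforward f L φ = f (cutoffComp χ L φ) := by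
  have hex : ∃ χ, IsCutoff f χ := ⟨χ, hχ⟩
  rw [pushforward, dif_pos hex]
  change f (cutoffComp hex.choose L φ) = _
  obtain ⟨h0, U, hU, hfU, hU1⟩ := hex.choose_spec
  obtain ⟨h0', U', hU', hfU', hU1'⟩ := hχ
  generalize hex.choose = ψ at *
  rw [← sub_eq_zero, ← map_sub]
  have hs : Function.support (cutoffComp ψ L φ - cutoffComp χ L φ) ⊆
      (tsupport ψ ∪ tsupport χ) ∩ (U ∩ U')ᶜ := by
    intro x hx
    constructor
    · by_contra h
      rw [Set.mem_union, not_or] at h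
      exact hx (by simp [image_eq_zero_of_notMem_tsupport h.1,
        image_eq_zero_of_notMem_tsupport h.2])
    · intro h
      exact hx (by simp [hU1 x h.1, hU1' x h.2])
  refine apply_eq_zero f _ (HasCompactSupport.of_support_subset_isCompact (h0.union h0')
    (hs.trans Set.inter_subset_left)) ?_
  have ht : tsupport (cutoffComp ψ L φ - cutoffComp χ L φ) ⊆ (U ∩ U')ᶜ :=
    closure_minimal (hs.trans Set.inter_subset_right) (hU.inter hU').isClosed_compl
  exact Set.disjoint_left.2 fun x hx hx' => ht hx ⟨hfU hx', hfU' hx'⟩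

end Pushforward

/-- The `k`-plane transform of a compactly supported distribution `f` on `ℝ^d`. In the fiber `αᗮ` it
is the image of `f` under the orthogonal projection `π_α : ℝ^d → αᗮ`, which is the transpose
`⟨Pf(α, ·), φ⟩ = ⟨f, φ ∘ π_α⟩` of integration over the planes `α + y = π_α⁻¹(y)`; it extends
`planeTransform`, see `distTransform_coe`. -/
def distTransform (k : ℕ) (f : 𝓢'(Euc d, ℂ)) : FiberDistribution k d :=
  fun α => pushforward f α.spaceᗮ.orthogonalProjectionOnto

/-- On Schwartz functions with compact support, `distTransform` is given by the integrals over
`k`-planes. -/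
theorem distTransform_coe (f : 𝓢(Euc d, ℂ)) (hf : HasCompactSupport f) (α : Grassmannian k d)
    (φ : 𝓢(α.spaceᗮ, ℂ)) :
    distTransform k (SchwartzMap.toTemperedDistributionCLM (Euc d) ℂ volume f) α φ =
      ∫ y : α.spaceᗮ, φ y * planeTransform f α y := by
  obtain ⟨χ, hχ, -, U, hU, hfU, hU1⟩ := exists_cutoff hf isOpen_univ (Set.subset_univ _)
  have hsup : Distribution.dsupport
      (SchwartzMap.toTemperedDistributionCLM (Euc d) ℂ volume f) ⊆ tsupport f := by
    refine Set.sInter_subset_of_mem ⟨fun u hu => ?_, isClosed_tsupport _⟩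
    refine (SchwartzMap.toTemperedDistributionCLM_apply_apply volume f u).trans ?_
    refine integral_eq_zero_of_ae (Filter.Eventually.of_forall fun x => ?_)
    by_cases hx : x ∈ tsupport u
    · simp [image_eq_zero_of_notMem_tsupport (hu hx)]
    · simp [image_eq_zero_of_notMem_tsupport hx]
  rw [distTransform, pushforward_eq ⟨hχ, U, hU, hsup.trans hfU, hU1⟩]
  refine (SchwartzMap.toTemperedDistributionCLM_apply_apply volume f _).trans ?_
  have h1 : ∀ x, cutoffComp χ α.spaceᗮ.orthogonalProjectionOnto φ x • f x =
      φ (α.spaceᗮ.orthogonalProjectionOnto x) * f x := by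
    intro x
    by_cases hx : x ∈ tsupport f
    · simp [hU1 x (hfU hx)]
    · simp [image_eq_zero_of_notMem_tsupport hx]
  simp_rw [h1]
  have hmp := (α.space.orthogonalDecomposition.symm.measurePreserving).comp
    (WithLp.volume_preserving_toLp (U := α.space) (V := α.spaceᗮ))
  have hme : MeasurableEmbedding
      (α.space.orthogonalDecomposition.symm ∘ WithLp.toLp 2 : α.space × α.spaceᗮ → Euc d) :=
    α.space.orthogonalDecomposition.symm.toHomeomorph.measurableEmbedding.comp
      (MeasurableEquiv.toLp 2 (α.space × α.spaceᗮ)).measurableEmbedding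
  have hval : ∀ p : α.space × α.spaceᗮ, (α.space.orthogonalDecomposition.symm ∘ WithLp.toLp 2) p =
      (p.1 : Euc d) + (p.2 : Euc d) := fun p => by simp
  have hpr : ∀ (x : α.space) (y : α.spaceᗮ),
      α.spaceᗮ.orthogonalProjectionOnto ((x : Euc d) + (y : Euc d)) = y := fun x y => by
    rw [map_add, Submodule.orthogonalProjectionOnto_mem_subspace_eq_self]
    simp [Submodule.orthogonalProjectionOnto_orthogonal_apply_eq_zero]
  have hint : Integrable (fun x => φ (α.spaceᗮ.orthogonalProjectionOnto x) * f x) := by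
    refine Continuous.integrable_of_hasCompactSupport (by fun_prop) ?_
    exact hf.mul_left
  rw [← hmp.integral_comp hme, Measure.volume_eq_prod, integral_prod_symm]
  · refine integral_congr_ae (Filter.Eventually.of_forall fun y => ?_)
    simp only [hval, hpr]
    exact integral_const_mul _ _
  · have := (hmp.integrable_comp_emb hme).2 hint
    rwa [Measure.volume_eq_prod] at this

end KPlane

end

/-!
The proof is the Fourier slice theorem followed by polar coordinates.

Let `f ∈ H^s` have support in the closure of `Ω`, let `χ` be a smooth compactly supported function
that is `1` near this set, and let `w ∈ L²((1 + |ξ|²)^s dξ)` be the Fourier transform of `f`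
(`exists_isGivenBy_of_memSobolev`). Since `f = χ f`, the function `G = (2π)^(-d/2) w ∗ χ̂`, which is
defined at *every* point, represents the Fourier transform of `f` as well. By Fubini, the Fourier
transform of the image of `f` under a linear map `L` is `G ∘ L†`, up to the normalizing factors
(`isGivenBy_fourierDist_pushforward`); for the projection onto `αᗮ` this says that the Fourier
transform of `Pf(α, ·)` is `(2π)^(k/2)` times the restriction of `G` to `αᗮ`. By Cauchy-Schwarz, `G`
is bounded on the unit ball by the `H^s` norm of `f`, with a constant that depends only on `s` and `χ`
(`exists_fourier_representative`).

The family of the spaces `αᗮ` covers `ℝ^d` with density proportional to `|ξ|^(-k)`: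
`∫_G ∫_{αᗮ} g(η) dη dα = κ ∫ g(ξ) |ξ|^(-k) dξ` (`exists_lintegral_grassmannian_eq`). Indeed, after
averaging over `O(d)` both sides are integrals of the radial function `x ↦ ∫ g(A x) dA`, over a fixed
space of dimension `d - k` and over `ℝ^d`, and polar coordinates apply to each.

Hence `‖Pf‖²` in `H^(s+k/2)` equals `(2π)^k κ ∫ |ξ|^(-k) (1 + |ξ|²)^(s+k/2) |G|² dξ`. The lower bound
follows from `|ξ|^k ≤ (1 + |ξ|²)^(k/2)`, with a constant that does not depend on `Ω`. For the upper
bound, `(1 + |ξ|²)^(k/2) ≤ 2^(k/2) |ξ|^k` where `|ξ| > 1`, while on the unit ball `G` is bounded and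
`|ξ|^(-k)` is integrable because `k < d`.
-/

noncomputable section

namespace KPlane

/-! ### Tempered distributions given by functions -/

section Fourier

variable {V : Type*} [NormedAddCommGroup V] [InnerProductSpace ℝ V] [FiniteDimensional ℝ V]
  [MeasurableSpace V] [BorelSpace V]

theorem IsGivenBy.locallyIntegrable {u : 𝓢'(V, ℂ)} {w : V → ℂ} (h : IsGivenBy u w) :
    LocallyIntegrable w := by
  rw [locallyIntegrable_iff]
  intro K hK
  obtain ⟨χ, -, -, U, -, hKU, hU⟩ := exists_cutoff hK isOpen_univ (Set.subset_univ _)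
  refine ((h.2 χ).1.integrableOn (s := K)).congr_fun (fun x hx => ?_) hK.measurableSet
  simp [hU x (hKU hx)]

/-- The function that represents a tempered distribution is unique almost everywhere. -/
theorem IsGivenBy.ae_eq {u : 𝓢'(V, ℂ)} {w₁ w₂ : V → ℂ} (h₁ : IsGivenBy u w₁)
    (h₂ : IsGivenBy u w₂) : w₁ =ᵐ[volume] w₂ := by
  have key : ∀ᵐ x : V, (w₁ - w₂) x = 0 := by
    refine ae_eq_zero_of_integral_contDiff_smul_eq_zero
      (h₁.locallyIntegrable.sub h₂.locallyIntegrable) fun g hg hgc => ?_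
    have hc : HasCompactSupport (Complex.ofRealCLM ∘ g) := hgc.comp_left rfl
    have hs : ContDiff ℝ ∞ (Complex.ofRealCLM ∘ g) := by fun_prop
    let φ : 𝓢(V, ℂ) := hc.toSchwartzMap hs
    have hφ : ∀ x, φ x = (g x : ℂ) := fun x => rfl
    calc ∫ x, g x • (w₁ - w₂) x = ∫ x, (φ x * w₁ x - φ x * w₂ x) := by
          congr 1; ext x; simp [hφ, mul_sub]
      _ = 0 := by
        rw [integral_sub (h₁.2 φ).1 (h₂.2 φ).1, ← (h₁.2 φ).2, ← (h₂.2 φ).2, sub_self]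
  filter_upwards [key] with x hx
  exact sub_eq_zero.1 hx

theorem energy_congr {s : ℝ} {w₁ w₂ : V → ℂ} (h : w₁ =ᵐ[volume] w₂) :
    energy s w₁ = energy s w₂ := by
  refine lintegral_congr_ae ?_
  filter_upwards [h] with x hx
  rw [hx]

theorem sobolevNorm_eq {s : ℝ} {u : 𝓢'(V, ℂ)} {w : V → ℂ} (h : IsGivenBy (fourierDist u) w) :
    sobolevNorm s u = energy s w ^ (1 / 2 : ℝ) := by
  refine le_antisymm (iInf₂_le w h) (le_iInf₂ fun w' h' => ?_)
  rw [energy_congr (h.ae_eq h')]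

theorem fourierConst_pos {V : Type*} [NormedAddCommGroup V] [InnerProductSpace ℝ V] :
    0 < fourierConst V := by
  unfold fourierConst; positivity

/-- The unitary Fourier transform is surjective on Schwartz functions, with the usual formula for the
inverse image `θ` of `ψ`. -/
theorem exists_fourierSchwartz_eq (ψ : 𝓢(V, ℂ)) : ∃ θ : 𝓢(V, ℂ), fourierSchwartz V θ = ψ ∧
    ∀ ζ, θ ζ = (fourierConst V : ℂ) *
      ∫ x : V, Complex.exp ((inner ℝ x ζ : ℝ) * Complex.I) * ψ x := by
  have h2π : (2 * Real.pi : ℝ) ≠ 0 := by positivity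
  let ψ' : 𝓢(V, ℂ) := SchwartzMap.compCLMOfContinuousLinearEquiv ℂ
      (ContinuousLinearEquiv.smulLeft (Units.mk0 (2 * Real.pi : ℝ) h2π) : V ≃L[ℝ] V) ψ
  have hψ' : ∀ x, ψ' x = ψ ((2 * Real.pi) • x) := fun x => rfl
  have hc : (fourierConst V : ℂ) ≠ 0 := by exact_mod_cast fourierConst_pos.ne'
  refine ⟨(fourierConst V : ℂ)⁻¹ • FourierTransformInv.fourierInv ψ', ?_, fun ζ => ?_⟩
  · ext ξ
    have h : ∀ φ : 𝓢(V, ℂ), (fourierSchwartz V φ) ξ =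
      (fourierConst V : ℂ) * (FourierTransform.fourier φ : 𝓢(V, ℂ)) ((2 * Real.pi)⁻¹ • ξ) :=
      fun φ => rfl
    rw [map_smul, smul_apply, h, FourierInvPair.fourier_fourierInv_eq, hψ', smul_smul,
      mul_inv_cancel₀ h2π, one_smul, smul_eq_mul, ← mul_assoc, inv_mul_cancel₀ hc, one_mul]
  · rw [smul_apply, SchwartzMap.fourierInv_coe, Real.fourierInv_eq']
    have h1 := Measure.integral_comp_smul (volume : Measure V)
      (fun x => Complex.exp ((inner ℝ x ζ : ℝ) * Complex.I) * ψ x) (2 * Real.pi)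
    simp only [inner_smul_left, conj_trivial] at h1
    simp only [hψ', smul_eq_mul]
    rw [h1, Complex.real_smul, ← mul_assoc]
    congr 1
    rw [inv_mul_eq_iff_eq_mul₀ hc]
    norm_cast
    rw [abs_of_pos (by positivity), fourierConst, ← Real.rpow_add (by positivity),
      ← Real.rpow_natCast, ← Real.rpow_neg (by positivity)]
    congr 1
    ring

theorem one_add_norm_le {V : Type*} [SeminormedAddCommGroup V] (ζ a : V) :
    1 + ‖ζ‖ ≤ (1 + ‖ζ - a‖) * (1 + ‖a‖) := by
  have := norm_add_le (ζ - a) a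
  rw [sub_add_cancel] at this
  nlinarith [norm_nonneg (ζ - a), norm_nonneg a]

/-- Translates of a Schwartz function decay rapidly, with polynomial loss in the translation. -/
theorem exists_schwartz_translate_bound {V : Type*} [NormedAddCommGroup V]
    [InnerProductSpace ℝ V] (θ : 𝓢(V, ℂ)) (M : ℕ) :
    ∃ B : ℝ, 0 < B ∧ ∀ ζ a, ‖θ (ζ - a)‖ ≤ B * (1 + ‖a‖) ^ M * ((1 + ‖ζ‖) ^ M)⁻¹ := by
  set B₀ := 2 ^ M * ((Finset.Iic (M, 0)).sup fun m => SchwartzMap.seminorm ℂ m.1 m.2) θ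
  have hB : ∀ x, (1 + ‖x‖) ^ M * ‖θ x‖ ≤ B₀ := fun x => by
    simpa using SchwartzMap.one_add_le_sup_seminorm_apply (𝕜 := ℂ) (m := (M, 0)) (k := M) (n := 0)
      le_rfl le_rfl θ x
  have hB0 : 0 ≤ B₀ := le_trans (by positivity) (hB 0)
  refine ⟨B₀ + 1, by positivity, fun ζ a => ?_⟩
  rw [← div_eq_mul_inv, le_div_iff₀ (by positivity)]
  calc ‖θ (ζ - a)‖ * (1 + ‖ζ‖) ^ M ≤ ‖θ (ζ - a)‖ * ((1 + ‖ζ - a‖) * (1 + ‖a‖)) ^ M := by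
        gcongr; exact one_add_norm_le ζ a
    _ = (1 + ‖ζ - a‖) ^ M * ‖θ (ζ - a)‖ * (1 + ‖a‖) ^ M := by rw [mul_pow]; ring
    _ ≤ (B₀ + 1) * (1 + ‖a‖) ^ M := by gcongr; linarith [hB (ζ - a)]

theorem one_add_sq_rpow_neg_le {V : Type*} [SeminormedAddCommGroup V] (s : ℝ) (x : V) :
    (1 + ‖x‖ ^ 2) ^ (-s) ≤ (1 + ‖x‖) ^ (2 * |s|) := by
  have h1 : (1 + ‖x‖ ^ 2) ^ (-s) ≤ (1 + ‖x‖ ^ 2) ^ |s| :=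
    Real.rpow_le_rpow_of_exponent_le (by nlinarith [norm_nonneg x]) (neg_le_abs s)
  refine h1.trans ?_
  rw [Real.rpow_mul (by positivity)]
  refine Real.rpow_le_rpow (by positivity) ?_ (abs_nonneg s)
  norm_cast
  nlinarith [norm_nonneg x]

/-- By Cauchy-Schwarz, a function of finite energy is integrable against `(1 + |ζ|)^(-M)`, for an
exponent `M` that depends only on `s` and the dimension. -/
theorem exists_weighted_integral_le (V : Type*) [NormedAddCommGroup V] [InnerProductSpace ℝ V]
    [FiniteDimensional ℝ V] [MeasurableSpace V] [BorelSpace V] (s : ℝ) :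
    ∃ M : ℕ, ∃ K : ℝ≥0∞, K ≠ ⊤ ∧ ∀ w : V → ℂ,
    AEStronglyMeasurable w → ∫⁻ ζ, ‖w ζ‖ₑ * ENNReal.ofReal ((1 + ‖ζ‖) ^ M)⁻¹ ≤
      K * energy s w ^ (1 / 2 : ℝ) := by
  -- `2M - 2|s|` has to exceed the dimension for `(1 + |ζ|²)^(-s) (1 + |ζ|)^(-2M)` to be integrable.
  obtain ⟨M, hM⟩ := exists_nat_gt (|s| + (Module.finrank ℝ V + 1 : ℝ))
  let g : V → ℝ := fun ζ => (1 + ‖ζ‖ ^ 2) ^ (-s / 2) * ((1 + ‖ζ‖) ^ M)⁻¹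
  have hg0 : ∀ ζ, 0 ≤ g ζ := fun ζ => by positivity
  have hsq : ∀ ζ, g ζ ^ 2 ≤ (1 + ‖ζ‖) ^ (-(Module.finrank ℝ V + 1 : ℝ)) := fun ζ => by
    have e1 : g ζ ^ 2 = (1 + ‖ζ‖ ^ 2) ^ (-s) * (1 + ‖ζ‖) ^ (-(2 * M : ℝ)) := by
      simp only [g, mul_pow]
      congr 1
      · rw [← Real.rpow_natCast, ← Real.rpow_mul (by positivity)]
        congr 1
        push_cast
        ring
      · rw [inv_pow, ← pow_mul, ← Real.rpow_natCast, ← Real.rpow_neg (by positivity)]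
        congr 2
        push_cast
        ring
    rw [e1]
    calc _ ≤ (1 + ‖ζ‖) ^ (2 * |s|) * (1 + ‖ζ‖) ^ (-(2 * M : ℝ)) := by
          gcongr; exact one_add_sq_rpow_neg_le s ζ
      _ = (1 + ‖ζ‖) ^ (2 * |s| + -(2 * M : ℝ)) := (Real.rpow_add (by positivity) _ _).symm
      _ ≤ _ := by
          refine Real.rpow_le_rpow_of_exponent_le (by linarith [norm_nonneg ζ]) ?_
          linarith [(Nat.cast_nonneg (Module.finrank ℝ V) : (0 : ℝ) ≤ _)]
  have hgm : Measurable g := by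
    unfold g
    fun_prop
  refine ⟨M, (∫⁻ ζ, ENNReal.ofReal (g ζ) ^ (2 : ℝ)) ^ (1 / 2 : ℝ), ?_, fun w hw => ?_⟩
  · refine ENNReal.rpow_ne_top_of_nonneg (by norm_num) (ne_of_lt ?_)
    have hi : Integrable (fun ζ : V => (1 + ‖ζ‖) ^ (-(Module.finrank ℝ V + 1 : ℝ))) volume :=
      integrable_one_add_norm (by linarith)
    refine lt_of_le_of_lt (lintegral_mono fun ζ => ?_) hi.lintegral_lt_top
    rw [ENNReal.ofReal_rpow_of_nonneg (hg0 ζ) (by norm_num)]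
    exact ENNReal.ofReal_le_ofReal (by exact_mod_cast hsq ζ)
  · have h := ENNReal.lintegral_mul_le_Lp_mul_Lq volume
      (Real.HolderConjugate.two_two)
      (f := fun ζ => ENNReal.ofReal (g ζ))
      (g := fun ζ => ENNReal.ofReal ((1 + ‖ζ‖ ^ 2) ^ (s / 2)) * ‖w ζ‖ₑ)
      hgm.ennreal_ofReal.aemeasurable
      ((Measurable.aemeasurable (by fun_prop)).mul hw.enorm)
    have e1 : ∀ ζ, ((fun ζ => ENNReal.ofReal (g ζ)) *
        fun ζ => ENNReal.ofReal ((1 + ‖ζ‖ ^ 2) ^ (s / 2)) * ‖w ζ‖ₑ) ζ =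
        ‖w ζ‖ₑ * ENNReal.ofReal ((1 + ‖ζ‖) ^ M)⁻¹ := fun ζ => by
      simp only [Pi.mul_apply]
      rw [← mul_assoc, ← ENNReal.ofReal_mul (hg0 ζ), mul_comm]
      congr 2
      simp only [g]
      rw [mul_right_comm, ← Real.rpow_add (by positivity), neg_div, neg_add_cancel, Real.rpow_zero,
        one_mul]
    have e2 : ∫⁻ ζ, (ENNReal.ofReal ((1 + ‖ζ‖ ^ 2) ^ (s / 2)) * ‖w ζ‖ₑ) ^ (2 : ℝ) =
        energy s w := by
      refine lintegral_congr fun ζ => ?_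
      rw [ENNReal.mul_rpow_of_nonneg _ _ (by norm_num),
        ENNReal.ofReal_rpow_of_nonneg (by positivity) (by norm_num),
        ← Real.rpow_mul (by positivity)]
      norm_num
    simp only [e1, e2] at h
    exact h

end Fourier

/-! ### Sobolev regularity and the energy of the Fourier transform -/

section Fourier

variable {V : Type*} [NormedAddCommGroup V] [InnerProductSpace ℝ V] [FiniteDimensional ℝ V]
  [MeasurableSpace V] [BorelSpace V]

/-- The dilation `φ ↦ φ(2π ·)` that relates the unitary Fourier transform to Mathlib's one. -/
def dilation (φ : 𝓢(V, ℂ)) : 𝓢(V, ℂ) :=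
  SchwartzMap.compCLMOfContinuousLinearEquiv ℂ
      (ContinuousLinearEquiv.smulLeft
        (Units.mk0 (2 * Real.pi : ℝ) (by positivity)) : V ≃L[ℝ] V) φ

theorem dilation_apply {V : Type*} [NormedAddCommGroup V] [InnerProductSpace ℝ V] (φ : 𝓢(V, ℂ))
    (x : V) : dilation φ x = φ ((2 * Real.pi) • x) := rfl

theorem fourierSchwartz_eq_smul_fourier_dilation (φ : 𝓢(V, ℂ)) :
    fourierSchwartz V φ =
      ((fourierConst V * (2 * Real.pi) ^ Module.finrank ℝ V : ℝ) : ℂ) •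
        FourierTransform.fourier (dilation φ) := by
  ext ξ
  have h1 := Measure.integral_comp_smul (volume : Measure V)
    (fun x => Complex.exp (-(inner ℝ x ξ : ℝ) * Complex.I) * φ x) (2 * Real.pi)
  rw [abs_of_pos (by positivity)] at h1
  rw [fourierSchwartz_apply, smul_apply, SchwartzMap.fourier_coe, Real.fourier_eq',
    smul_eq_mul, Complex.ofReal_mul, mul_assoc]
  congr 1
  have h2 : ∀ x : V, Complex.exp ((-2 * Real.pi * inner ℝ x ξ : ℝ) * Complex.I) • dilation φ x =
      Complex.exp (-(inner ℝ ((2 * Real.pi) • x) ξ : ℝ) * Complex.I) *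
        φ ((2 * Real.pi) • x) := fun x => by
    rw [dilation_apply, smul_eq_mul, inner_smul_left]
    congr 3
    simp only [conj_trivial]
    push_cast
    ring
  simp_rw [h2, h1, Complex.real_smul]
  rw [← mul_assoc, ← Complex.ofReal_mul, mul_inv_cancel₀ (by positivity), Complex.ofReal_one,
    one_mul]

theorem one_add_sq_smul_rpow_le {V : Type*} [NormedAddCommGroup V] [NormedSpace ℝ V] (s : ℝ)
    (x : V) :
    (1 + ‖(2 * Real.pi) • x‖ ^ 2) ^ s ≤
      ((2 * Real.pi) ^ 2) ^ |s| * (1 + ‖x‖ ^ 2) ^ s := by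
  have hπ : 1 ≤ (2 * Real.pi) ^ 2 := by nlinarith [Real.pi_gt_three]
  have e : ‖(2 * Real.pi) • x‖ ^ 2 = (2 * Real.pi) ^ 2 * ‖x‖ ^ 2 := by
    rw [norm_smul, mul_pow, Real.norm_of_nonneg (by positivity)]
  have hx : 0 ≤ ‖x‖ ^ 2 := by positivity
  rw [e]
  rcases le_total 0 s with hs | hs
  · rw [abs_of_nonneg hs, ← Real.mul_rpow (by positivity) (by positivity)]
    refine Real.rpow_le_rpow (by positivity) ?_ hs
    nlinarith
  · have h1 : (1 : ℝ) ≤ ((2 * Real.pi) ^ 2) ^ |s| := Real.one_le_rpow hπ (abs_nonneg s)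
    have h2 : (1 + (2 * Real.pi) ^ 2 * ‖x‖ ^ 2) ^ s ≤ (1 + ‖x‖ ^ 2) ^ s :=
      Real.rpow_le_rpow_of_nonpos (by positivity) (by nlinarith) hs
    nlinarith [Real.rpow_nonneg (by positivity : 0 ≤ 1 + ‖x‖ ^ 2) s]

/-- The Fourier transform of a distribution in `H^s` is a function of finite energy. -/
theorem exists_isGivenBy_of_memSobolev {s : ℝ} {f : 𝓢'(V, ℂ)}
    (hf : TemperedDistribution.MemSobolev s 2 f) :
    ∃ w : V → ℂ, StronglyMeasurable w ∧ IsGivenBy (fourierDist f) w ∧ energy s w < ⊤ := by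
  obtain ⟨v, hv⟩ := TemperedDistribution.memSobolev_iff_exists_smulLeftCLM_fourier.1 hf
  have hπ : (2 * Real.pi : ℝ) ≠ 0 := by positivity
  set c : ℝ := fourierConst V * (2 * Real.pi) ^ Module.finrank ℝ V
  -- `(1 + |x|²)^(s/2)` times Mathlib's Fourier transform of `f` is `v ∈ L²`; divide by the weight and
  -- dilate.
  let m : V → ℂ := fun x => (((1 + ‖x‖ ^ 2) ^ (-s / 2) : ℝ) : ℂ)
  have hm : Function.HasTemperateGrowth m := by
    unfold m; fun_prop
  have hmc : Continuous m := hm.1.continuous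
  let g : V → ℂ := fun x => (fourierConst V : ℂ) * (m x * v x)
  have hgm : StronglyMeasurable g :=
    (hmc.stronglyMeasurable.mul (Lp.stronglyMeasurable v)).const_mul _
  have hsm : Continuous fun x : V => (2 * Real.pi)⁻¹ • x := by fun_prop
  have hinv : ∀ x : V, (2 * Real.pi)⁻¹ • (2 * Real.pi) • x = x := fun x => by
    rw [smul_smul, inv_mul_cancel₀ hπ, one_smul]
  let ψ : 𝓢(V, ℂ) → 𝓢(V, ℂ) := fun φ => SchwartzMap.smulLeftCLM ℂ m (dilation φ)
  have hψ : ∀ φ x, ψ φ x = m x * φ ((2 * Real.pi) • x) := fun φ x => by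
    simp only [ψ, SchwartzMap.smulLeftCLM_apply_apply hm, smul_eq_mul, dilation_apply]
  have hint : ∀ φ, Integrable fun x => ψ φ x * v x := fun φ =>
    ((ψ φ).memLp 2 volume).integrable_mul (Lp.memLp v)
  have happ : ∀ φ, (FourierTransform.fourier f : 𝓢'(V, ℂ)) (dilation φ) =
      ∫ x, ψ φ x * v x := fun φ => by
    have h := congrArg (fun T : 𝓢'(V, ℂ) => T (ψ φ)) hv
    simp only [TemperedDistribution.smulLeftCLM_apply_apply, Lp.toTemperedDistribution_apply,
      smul_eq_mul] at h
    rw [← h]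
    congr 1
    ext x
    rw [SchwartzMap.smulLeftCLM_apply_apply (by fun_prop), hψ, smul_eq_mul, ← mul_assoc,
      ← Complex.ofReal_mul, ← Real.rpow_add (by positivity), neg_div, add_neg_cancel,
      Real.rpow_zero, Complex.ofReal_one, one_mul, dilation_apply]
  have hprod : ∀ (φ : 𝓢(V, ℂ)) (x : V),
      φ ((2 * Real.pi) • x) * g ((2 * Real.pi)⁻¹ • (2 * Real.pi) • x) =
        (fourierConst V : ℂ) * (ψ φ x * v x) := fun φ x => by
    rw [hinv, hψ]; simp only [g]; ring
  refine ⟨fun y => g ((2 * Real.pi)⁻¹ • y), hgm.comp_measurable hsm.measurable,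
    ⟨(hgm.comp_measurable hsm.measurable).aestronglyMeasurable, fun φ => ⟨?_, ?_⟩⟩, ?_⟩
  · refine (integrable_comp_smul_iff volume
      (fun y => φ y * g ((2 * Real.pi)⁻¹ • y)) hπ).1 ?_
    simp only [hprod]
    exact (hint φ).const_mul _
  · have h1 := Measure.integral_comp_smul (volume : Measure V)
      (fun y => φ y * g ((2 * Real.pi)⁻¹ • y)) (2 * Real.pi)
    simp only [hprod] at h1
    rw [abs_of_pos (by positivity), integral_const_mul, ← happ, Complex.real_smul] at h1
    change f (fourierSchwartz V φ) = _
    rw [fourierSchwartz_eq_smul_fourier_dilation, map_smul, smul_eq_mul]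
    change (c : ℂ) * (FourierTransform.fourier f : 𝓢'(V, ℂ)) (dilation φ) = _
    have hc : (c : ℂ) = (fourierConst V : ℂ) * ((2 * Real.pi) ^ Module.finrank ℝ V : ℝ) := by
      simp only [c]; push_cast; ring
    rw [hc, mul_right_comm, h1, mul_comm, ← mul_assoc, ← Complex.ofReal_mul,
      mul_inv_cancel₀ (by positivity), Complex.ofReal_one, one_mul]
  · let G : V → ℝ≥0∞ := fun y => ENNReal.ofReal ((1 + ‖y‖ ^ 2) ^ s) *
      ‖g ((2 * Real.pi)⁻¹ • y)‖ₑ ^ 2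
    have hG : Measurable G := by
      have := (hgm.comp_measurable hsm.measurable).measurable.enorm
      unfold G
      fun_prop
    have h1 : ∫⁻ x, G ((2 * Real.pi) • x) < ⊤ := by
      have hv2 : ∫⁻ x, ‖v x‖ₑ ^ 2 < ⊤ := by
        have := (Lp.memLp v).2
        rw [eLpNorm_lt_top_iff_lintegral_rpow_enorm_lt_top (by norm_num) (by norm_num)] at this
        simpa using this
      refine lt_of_le_of_lt (b := ∫⁻ x, ENNReal.ofReal (((2 * Real.pi) ^ 2) ^ |s| *
        fourierConst V ^ 2) * ‖v x‖ₑ ^ 2) (lintegral_mono fun x => ?_) ?_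
      · simp only [G, hinv]
        have hm2 : ‖g x‖ₑ ^ 2 =
            ENNReal.ofReal (fourierConst V ^ 2 * (1 + ‖x‖ ^ 2) ^ (-s)) * ‖v x‖ₑ ^ 2 := by
          simp only [g, m, enorm_mul, mul_pow, ← mul_assoc]
          congr 1
          rw [← ofReal_norm, ← ofReal_norm, Complex.norm_real, Complex.norm_real,
            Real.norm_of_nonneg fourierConst_pos.le, Real.norm_of_nonneg (by positivity),
            ← ENNReal.ofReal_pow fourierConst_pos.le, ← ENNReal.ofReal_pow (by positivity),
            ← ENNReal.ofReal_mul (by positivity), ← Real.rpow_natCast (_ ^ (-s / 2)),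
            ← Real.rpow_mul (by positivity)]
          congr 3
          push_cast
          ring
        rw [hm2, ← mul_assoc, ← ENNReal.ofReal_mul (by positivity)]
        gcongr ENNReal.ofReal ?_ * _
        have h3 : (1 + ‖x‖ ^ 2) ^ s * (1 + ‖x‖ ^ 2) ^ (-s) = 1 := by
          rw [← Real.rpow_add (by positivity), add_neg_cancel, Real.rpow_zero]
        calc _ ≤ (((2 * Real.pi) ^ 2) ^ |s| * (1 + ‖x‖ ^ 2) ^ s) *
            (fourierConst V ^ 2 * (1 + ‖x‖ ^ 2) ^ (-s)) := by
              gcongr; exact one_add_sq_smul_rpow_le s x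
          _ = ((2 * Real.pi) ^ 2) ^ |s| * fourierConst V ^ 2 *
            ((1 + ‖x‖ ^ 2) ^ s * (1 + ‖x‖ ^ 2) ^ (-s)) := by ring
          _ = _ := by rw [h3, mul_one]
      · rw [lintegral_const_mul' _ _ ENNReal.ofReal_ne_top]
        exact ENNReal.mul_lt_top ENNReal.ofReal_lt_top hv2
    have h2 := lintegral_map (μ := (volume : Measure V)) hG
      (measurable_const_smul (2 * Real.pi))
    rw [Measure.map_addHaar_smul volume hπ, lintegral_smul_measure] at h2
    rw [← h2, smul_eq_mul] at h1
    refine ENNReal.lt_top_of_mul_ne_top_right h1.ne ?_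
    simp only [ne_eq, ENNReal.ofReal_eq_zero, not_le]
    positivity

end Fourier

/-! ### Removing the cutoff function -/

section Cutoff

open Filter Topology

variable {V : Type*} [NormedAddCommGroup V] [NormedSpace ℝ V]

/-- The derivatives of `x ↦ χ (ε x) - χ 0` are `O(ε)`, with linear growth in `x`. -/
theorem exists_iteratedFDeriv_rescale_sub_le (χ : 𝓢(V, ℂ)) (i : ℕ) : ∃ B : ℝ, 0 ≤ B ∧
    ∀ ε : ℝ, |ε| ≤ 1 → ∀ x, ‖iteratedFDeriv ℝ i (fun x => χ (ε • x) - χ 0) x‖ ≤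
      B * |ε| * (1 + ‖x‖) := by
  have hsm : ∀ n : ℕ, ContDiff ℝ n χ := fun n => (χ.smooth ⊤).of_le (mod_cast le_top)
  rcases Nat.eq_zero_or_pos i with rfl | hi
  · refine ⟨SchwartzMap.seminorm ℂ 0 1 χ, apply_nonneg _ _, fun ε _ x => ?_⟩
    have hd : ∀ y ∈ (Set.univ : Set V), ‖fderiv ℝ χ y‖ ≤ SchwartzMap.seminorm ℂ 0 1 χ :=
      fun y _ => by
        have := SchwartzMap.le_seminorm ℂ 0 1 χ y
        rwa [pow_zero, one_mul, ← norm_fderiv_iteratedFDeriv, norm_fderiv_iteratedFDeriv,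
          zero_add, norm_iteratedFDeriv_one] at this
    have h := convex_univ.norm_image_sub_le_of_norm_fderiv_le (𝕜 := ℝ)
      (fun y _ => χ.differentiableAt) hd (Set.mem_univ (0 : V)) (Set.mem_univ (ε • x))
    rw [norm_iteratedFDeriv_zero]
    refine h.trans ?_
    rw [sub_zero, norm_smul, Real.norm_eq_abs, mul_assoc]
    gcongr
    linarith [norm_nonneg x]
  · refine ⟨SchwartzMap.seminorm ℂ 0 i χ, apply_nonneg _ _, fun ε hε x => ?_⟩
    have hc : ContDiff ℝ i fun x : V => χ (ε • x) := (hsm i).comp (contDiff_const_smul ε)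
    have e : iteratedFDeriv ℝ i (fun x => χ (ε • x) - χ 0) x =
        ε ^ i • iteratedFDeriv ℝ i χ (ε • x) := by
      have h1 := iteratedFDeriv_sub_apply (x := x) hc.contDiffAt
        (contDiff_const (c := χ 0)).contDiffAt
      rw [iteratedFDeriv_const_of_ne hi.ne'] at h1
      have h2 := congrFun (iteratedFDeriv_comp_const_smul ε (hsm i)) x
      rw [← h2]
      simpa [Pi.sub_def] using h1
    have h3 := SchwartzMap.le_seminorm ℂ 0 i χ (ε • x)
    rw [pow_zero, one_mul] at h3
    have h4 : |ε| ^ i ≤ |ε| := by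
      simpa using pow_le_pow_of_le_one (abs_nonneg ε) hε (Nat.one_le_iff_ne_zero.2 hi.ne')
    rw [e, norm_smul, norm_pow, Real.norm_eq_abs]
    calc _ ≤ |ε| * SchwartzMap.seminorm ℂ 0 i χ := by gcongr
      _ = SchwartzMap.seminorm ℂ 0 i χ * |ε| * 1 := by ring
      _ ≤ _ := by gcongr; linarith [norm_nonneg x]

/-- Truncations `φ(x) χ(ε x)`, with `χ 0 = 1`, of a Schwartz function `φ` converge to `φ`. -/
theorem tendsto_cutoffComp_smul_id (φ χ : 𝓢(V, ℂ)) (hχ : χ 0 = 1) :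
    Tendsto (fun ε : ℝ => cutoffComp φ (ε • ContinuousLinearMap.id ℝ V) χ) (𝓝 0) (𝓝 φ) := by
  rw [(schwartz_withSeminorms ℂ V ℂ).tendsto_nhds]
  rintro ⟨l, n⟩ δ hδ
  choose B hB0 hB using exists_iteratedFDeriv_rescale_sub_le χ
  set D : ℝ := ∑ i ∈ Finset.range (n + 1), (n.choose i : ℝ) *
    (SchwartzMap.seminorm ℂ l i φ + SchwartzMap.seminorm ℂ (l + 1) i φ) * B (n - i) with hD
  have hD0 : 0 ≤ D := Finset.sum_nonneg fun i _ => by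
    have := hB0 (n - i); positivity
  have hbound : ∀ ε : ℝ, |ε| ≤ 1 → SchwartzMap.seminorm ℂ l n
      (cutoffComp φ (ε • ContinuousLinearMap.id ℝ V) χ - φ) ≤ D * |ε| := fun ε hε => by
    refine SchwartzMap.seminorm_le_bound ℂ l n _ (by positivity) fun x => ?_
    have e : ⇑(cutoffComp φ (ε • ContinuousLinearMap.id ℝ V) χ - φ) =
        fun x => φ x * (χ (ε • x) - χ 0) := by
      ext y
      simp [hχ, mul_sub]
    have hψ : ContDiff ℝ ∞ fun x : V => χ (ε • x) - χ 0 :=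
      ((χ.smooth ⊤).comp (contDiff_const_smul ε)).sub contDiff_const
    rw [e]
    have h1 := norm_iteratedFDeriv_mul_le (𝕜 := ℝ) (n := n) (N := ∞)
        (φ.smooth ⊤) hψ x (mod_cast le_top)
    refine (mul_le_mul_of_nonneg_left h1 (by positivity)).trans ?_
    rw [Finset.mul_sum, hD, Finset.sum_mul]
    refine Finset.sum_le_sum fun i _ => ?_
    have h2 := SchwartzMap.le_seminorm ℂ l i φ x
    have h3 := SchwartzMap.le_seminorm ℂ (l + 1) i φ x
    have h4 := hB (n - i) ε hε x
    have h5 := hB0 (n - i)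
    calc ‖x‖ ^ l * ((n.choose i : ℝ) * ‖iteratedFDeriv ℝ i φ x‖ *
          ‖iteratedFDeriv ℝ (n - i) (fun x => χ (ε • x) - χ 0) x‖)
        ≤ ‖x‖ ^ l * ((n.choose i : ℝ) * ‖iteratedFDeriv ℝ i φ x‖ *
          (B (n - i) * |ε| * (1 + ‖x‖))) := by gcongr
      _ = (n.choose i : ℝ) * (‖x‖ ^ l * ‖iteratedFDeriv ℝ i φ x‖ +
          ‖x‖ ^ (l + 1) * ‖iteratedFDeriv ℝ i φ x‖) * B (n - i) * |ε| := by ring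
      _ ≤ _ := by gcongr
  have ht : Tendsto (fun ε : ℝ => D * |ε|) (𝓝 0) (𝓝 0) := by
    have : Continuous fun ε : ℝ => D * |ε| := by fun_prop
    simpa using this.tendsto 0
  have h1 : ∀ᶠ ε : ℝ in 𝓝 0, |ε| ≤ 1 := by
    have := Metric.ball_mem_nhds (0 : ℝ) one_pos
    filter_upwards [this] with ε hε
    simpa using (Metric.mem_ball.1 hε).le
  filter_upwards [h1, ht.eventually (gt_mem_nhds hδ)] with ε h2 h3
  exact (hbound ε h2).trans_lt h3

/-- A compactly supported distribution does not see a cutoff function; here the test function need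
not be compactly supported. -/
theorem IsCutoff.apply_cutoffComp_id [FiniteDimensional ℝ V] {f : 𝓢'(V, ℂ)} {χ : 𝓢(V, ℂ)}
    (hχ : IsCutoff f χ) (φ : 𝓢(V, ℂ)) :
    f (cutoffComp χ (ContinuousLinearMap.id ℝ V) φ) = f φ := by
  obtain ⟨χ₀, hc, -, U₀, -, h0, hU₀⟩ := exists_cutoff (isCompact_singleton (x := (0 : V)))
    isOpen_univ (Set.subset_univ _)
  have ht := tendsto_cutoffComp_smul_id φ χ₀ (hU₀ 0 (h0 rfl))
  have ht' : Tendsto (fun ε : ℝ => cutoffComp φ (ε • ContinuousLinearMap.id ℝ V) χ₀)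
    (𝓝[≠] 0) (𝓝 φ) := ht.mono_left nhdsWithin_le_nhds
  have h1 := (f.continuous.tendsto φ).comp ht'
  have h2 := ((f.continuous.comp (cutoffComp χ (ContinuousLinearMap.id ℝ V)).continuous).tendsto
    φ).comp ht'
  refine tendsto_nhds_unique (h2.congr' ?_) h1
  filter_upwards [self_mem_nhdsWithin] with ε hε
  obtain ⟨-, U, hU, hfU, hU1⟩ := hχ
  simp only [Function.comp_apply]
  set ψ := cutoffComp φ (ε • ContinuousLinearMap.id ℝ V) χ₀
  have hψ : HasCompactSupport ψ :=
    (hc.comp_homeomorph (Homeomorph.smulOfNeZero ε hε)).mul_left (f := φ)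
  refine sub_eq_zero.1 ((map_sub f _ _).symm.trans ?_)
  have hs : Function.support (cutoffComp χ (ContinuousLinearMap.id ℝ V) ψ - ψ) ⊆ tsupport ψ :=
    fun x hx => by
      by_contra h
      exact hx (by simp [image_eq_zero_of_notMem_tsupport h])
  have hs' : Function.support (cutoffComp χ (ContinuousLinearMap.id ℝ V) ψ - ψ) ⊆ Uᶜ :=
    fun x hx h => hx (by simp [hU1 x h])
  exact apply_eq_zero f _ (HasCompactSupport.of_support_subset_isCompact hψ hs)
    (Set.disjoint_left.2 fun x hx hx' =>
      closure_minimal hs' hU.isClosed_compl hx (hfU hx'))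

theorem IsCutoff.pushforward_id [FiniteDimensional ℝ V] {f : 𝓢'(V, ℂ)} {χ : 𝓢(V, ℂ)}
    (hχ : IsCutoff f χ) : pushforward f (ContinuousLinearMap.id ℝ V) = f := by
  ext φ
  rw [pushforward_eq hχ, hχ.apply_cutoffComp_id]

end Cutoff

/-! ### The Fourier slice theorem -/

section Slice

variable {V W : Type*} [NormedAddCommGroup V] [InnerProductSpace ℝ V] [FiniteDimensional ℝ V]
  [MeasurableSpace V] [BorelSpace V] [NormedAddCommGroup W] [InnerProductSpace ℝ W]
  [FiniteDimensional ℝ W] [MeasurableSpace W] [BorelSpace W]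

/-- With `θ` the inverse Fourier transform of `χ`, the one of `χ · (φ̂ ∘ L)` is the superposition of
the translates `θ(· - L† η)` with weight `φ(η)`. -/
theorem inverseFourier_cutoffComp_fourierSchwartz {χ θ : 𝓢(V, ℂ)}
    (hθ : ∀ ζ, θ ζ = (fourierConst V : ℂ) *
      ∫ x : V, Complex.exp ((inner ℝ x ζ : ℝ) * Complex.I) * χ x)
    (L : V →L[ℝ] W) (φ : 𝓢(W, ℂ)) (ζ : V) :
    (fourierConst V : ℂ) * ∫ x : V, Complex.exp ((inner ℝ x ζ : ℝ) * Complex.I) *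
        cutoffComp χ L (fourierSchwartz W φ) x =
      (fourierConst W : ℂ) * ∫ η : W, φ η * θ (ζ - L.adjoint η) := by
  let K : V → W → ℂ := fun x η => (Complex.exp ((inner ℝ x ζ : ℝ) * Complex.I) * χ x) *
    (Complex.exp (-(inner ℝ η (L x) : ℝ) * Complex.I) * φ η)
  have hK : Integrable (Function.uncurry K) := by
    have h1 : Integrable (fun p : V × W => χ p.1 * φ p.2) (volume.prod volume) :=
      χ.integrable.mul_prod φ.integrable
    refine h1.congr' (Continuous.aestronglyMeasurable ?_) (Filter.Eventually.of_forall fun p => ?_)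
    · unfold K Function.uncurry; fun_prop
    · simp only [K, Function.uncurry, norm_mul, ← Complex.ofReal_neg,
        Complex.norm_exp_ofReal_mul_I, one_mul]
  calc _ = (fourierConst V : ℂ) * ∫ x : V, (fourierConst W : ℂ) * ∫ η : W, K x η := by
        congr 2; ext x
        rw [cutoffComp_apply, fourierSchwartz_apply, ← mul_assoc, mul_left_comm,
          ← integral_const_mul]
    _ = (fourierConst W : ℂ) * ((fourierConst V : ℂ) * ∫ η : W, ∫ x : V, K x η) := by
        rw [integral_const_mul, integral_integral_swap hK]; ring
    _ = _ := by
        rw [← integral_const_mul]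
        congr 2; ext η
        rw [hθ, mul_left_comm (φ η), ← integral_const_mul (φ η)]
        congr 2; ext x
        simp only [K]
        rw [inner_sub_right, L.adjoint_inner_right, real_inner_comm η (L x), Complex.ofReal_sub,
          sub_mul, sub_eq_add_neg, Complex.exp_add, neg_mul]
        ring

/-- **Fourier slice theorem.** If `f` is compactly supported and `f̂ = w`, then the Fourier transform
of `L_* f` is the pull back under `L†` of the smooth version `w ∗ χ̂` of `w`. -/
theorem isGivenBy_fourierDist_pushforward {f : 𝓢'(V, ℂ)} {χ θ : 𝓢(V, ℂ)} (hχ : IsCutoff f χ)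
    (hθ : ∀ ζ, θ ζ = (fourierConst V : ℂ) *
      ∫ x : V, Complex.exp ((inner ℝ x ζ : ℝ) * Complex.I) * χ x)
    {w : V → ℂ} (hw : IsGivenBy (fourierDist f) w) {M : ℕ}
    (hM : Integrable fun ζ => ‖w ζ‖ * ((1 + ‖ζ‖) ^ M)⁻¹) (L : V →L[ℝ] W) :
    IsGivenBy (fourierDist (pushforward f L))
      (fun η => (fourierConst W : ℂ) * ∫ ζ, w ζ * θ (ζ - L.adjoint η)) := by
  have hmeas : AEStronglyMeasurable (fun p : W × V => w p.2 * θ (p.2 - L.adjoint p.1))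
      (volume.prod volume) :=
    hw.1.comp_snd.mul (Continuous.aestronglyMeasurable (by fun_prop))
  refine ⟨hmeas.integral_prod_right'.const_mul _, fun φ => ?_⟩
  -- Pairing with `φ` gives the double integral of `H`, in the order `ζ`, `η` for `L_* f` and in the
  -- order `η`, `ζ` for the function on the right.
  let H : W → V → ℂ := fun η ζ => φ η * (w ζ * θ (ζ - L.adjoint η))
  have hH : Integrable (Function.uncurry H) (volume.prod volume) := by
    obtain ⟨B, hB, hBθ⟩ := exists_schwartz_translate_bound θ M
    have hφ : Integrable fun η : W => ‖φ η‖ * (1 + ‖η‖) ^ M := by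
      refine Integrable.mono' (g := fun η => 2 ^ (M - 1) * (‖φ η‖ + ‖η‖ ^ M * ‖φ η‖))
        ((φ.integrable.norm.add (φ.integrable_pow_mul volume M)).const_mul _)
        (Continuous.aestronglyMeasurable (by fun_prop)) (Filter.Eventually.of_forall fun η => ?_)
      rw [Real.norm_of_nonneg (by positivity)]
      have := add_pow_le zero_le_one (norm_nonneg η) M
      rw [one_pow] at this
      calc _ ≤ ‖φ η‖ * (2 ^ (M - 1) * (1 + ‖η‖ ^ M)) := by gcongr
        _ = _ := by ring
    have h1 := (hφ.mul_prod hM).const_mul (B * (1 + ‖L.adjoint‖) ^ M)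
    refine Integrable.mono' h1 ?_ (Filter.Eventually.of_forall fun p => ?_)
    · exact (Continuous.aestronglyMeasurable (by fun_prop)).mul hmeas
    · simp only [Function.uncurry, H, norm_mul]
      have h2 := hBθ p.2 (L.adjoint p.1)
      have h3 : 1 + ‖L.adjoint p.1‖ ≤ (1 + ‖L.adjoint‖) * (1 + ‖p.1‖) := by
        nlinarith [L.adjoint.le_opNorm p.1, norm_nonneg L.adjoint, norm_nonneg p.1]
      calc ‖φ p.1‖ * (‖w p.2‖ * ‖θ (p.2 - L.adjoint p.1)‖)
          ≤ ‖φ p.1‖ * (‖w p.2‖ * (B * ((1 + ‖L.adjoint‖) * (1 + ‖p.1‖)) ^ M *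
            ((1 + ‖p.2‖) ^ M)⁻¹)) := by
              gcongr
              refine h2.trans ?_
              gcongr
        _ = _ := by rw [mul_pow]; ring
  have e : ∀ η, φ η * ((fourierConst W : ℂ) * ∫ ζ, w ζ * θ (ζ - L.adjoint η)) =
      (fourierConst W : ℂ) * ∫ ζ, H η ζ := fun η => by
    rw [mul_left_comm, ← integral_const_mul]
  simp only [e]
  refine ⟨hH.integral_prod_left.const_mul _, ?_⟩
  obtain ⟨θ', h1, h2⟩ := exists_fourierSchwartz_eq (cutoffComp χ L (fourierSchwartz W φ))
  change pushforward f L (fourierSchwartz W φ) = _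
  rw [pushforward_eq hχ, ← h1]
  refine (hw.2 θ').2.trans ?_
  rw [integral_const_mul, integral_integral_swap hH, ← integral_const_mul]
  congr 1; ext ζ
  rw [h2, inverseFourier_cutoffComp_fourierSchwartz hθ, mul_assoc, ← integral_mul_const]
  congr 2; ext η
  simp only [H]; ring

/-- The Fourier transform of a distribution `f ∈ H^s` with cutoff function `χ` is represented by an
everywhere defined function `G` that is bounded on the unit ball by the `H^s` norm and whose
restriction to any subspace `U` is, up to a factor, the Fourier transform of the image of `f` under
the orthogonal projection onto `U`. The constant `B` does not depend on `f`. -/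
theorem exists_fourier_representative (χ : 𝓢(V, ℂ)) (s : ℝ) : ∃ B : ℝ≥0∞, B ≠ ⊤ ∧
    ∀ f : 𝓢'(V, ℂ), IsCutoff f χ → TemperedDistribution.MemSobolev s 2 f →
    ∃ G : V → ℂ, Measurable G ∧ IsGivenBy (fourierDist f) G ∧ energy s G < ⊤ ∧
      (∀ a, ‖a‖ ≤ 1 → ‖G a‖ₑ ^ 2 ≤ B * energy s G) ∧
      ∀ U : Submodule ℝ V, IsGivenBy (fourierDist (pushforward f U.orthogonalProjectionOnto))
        (fun η => ((fourierConst U / fourierConst V : ℝ) : ℂ) * G η) := by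
  obtain ⟨θ, -, hθ⟩ := exists_fourierSchwartz_eq χ
  obtain ⟨M, K, hK, hKw⟩ := exists_weighted_integral_le V s
  obtain ⟨B, hB, hBθ⟩ := exists_schwartz_translate_bound θ M
  have hc : (fourierConst V : ℂ) ≠ 0 := by exact_mod_cast fourierConst_pos.ne'
  refine ⟨(ENNReal.ofReal (fourierConst V * (B * 2 ^ M)) * K) ^ 2,
    ENNReal.pow_ne_top (ENNReal.mul_ne_top ENNReal.ofReal_ne_top hK), fun f hf hs => ?_⟩
  obtain ⟨w, hwm, hw, hwe⟩ := exists_isGivenBy_of_memSobolev hs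
  have hwK := hKw w hwm.aestronglyMeasurable
  have hM : Integrable fun ζ => ‖w ζ‖ * ((1 + ‖ζ‖) ^ M)⁻¹ := by
    refine ⟨hwm.aestronglyMeasurable.norm.mul
      (Continuous.aestronglyMeasurable (by fun_prop (disch := intros; positivity))), ?_⟩
    refine lt_of_le_of_lt (le_of_eq ?_) (hwK.trans_lt
      (ENNReal.mul_lt_top hK.lt_top (ENNReal.rpow_lt_top_of_nonneg (by norm_num) hwe.ne)))
    refine lintegral_congr fun ζ => ?_
    rw [enorm_mul, enorm_norm, Real.enorm_of_nonneg (by positivity)]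
  let G : V → ℂ := fun a => (fourierConst V : ℂ) * ∫ ζ, w ζ * θ (ζ - a)
  have hGm : Measurable G := by
    have h1 : StronglyMeasurable fun p : V × V => w p.2 * θ (p.2 - p.1) :=
      (hwm.comp_measurable measurable_snd).mul (Continuous.stronglyMeasurable (by fun_prop))
    exact (h1.integral_prod_right'.const_mul _).measurable
  have hG : IsGivenBy (fourierDist f) G := by
    have h1 := isGivenBy_fourierDist_pushforward hf hθ hw hM (ContinuousLinearMap.id ℝ V)
    rw [hf.pushforward_id] at h1
    simpa [G, ContinuousLinearMap.adjoint_id] using h1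
  have hGe : energy s G = energy s w := energy_congr (hG.ae_eq hw)
  refine ⟨G, hGm, hG, hGe ▸ hwe, fun a ha => ?_, fun U => ?_⟩
  · have h1 : ‖G a‖ₑ ≤ ENNReal.ofReal (fourierConst V * (B * 2 ^ M)) *
        (K * energy s w ^ (1 / 2 : ℝ)) := by
      simp only [G, enorm_mul]
      rw [ENNReal.ofReal_mul fourierConst_pos.le, mul_assoc]
      have hcV : ‖(fourierConst V : ℂ)‖ₑ = ENNReal.ofReal (fourierConst V) := by
        rw [← ofReal_norm, Complex.norm_real, Real.norm_of_nonneg fourierConst_pos.le]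
      rw [hcV]
      gcongr
      have h2 : ENNReal.ofReal (B * 2 ^ M) * ∫⁻ ζ, ‖w ζ‖ₑ * ENNReal.ofReal ((1 + ‖ζ‖) ^ M)⁻¹ ≤
          ENNReal.ofReal (B * 2 ^ M) * (K * energy s w ^ (1 / 2 : ℝ)) := by gcongr
      refine (enorm_integral_le_lintegral_enorm _).trans (le_trans ?_ h2)
      rw [← lintegral_const_mul' _ _ ENNReal.ofReal_ne_top]
      refine lintegral_mono fun ζ => ?_
      rw [enorm_mul, mul_left_comm, ← ENNReal.ofReal_mul (by positivity), ← ofReal_norm (θ _)]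
      gcongr
      refine (hBθ ζ a).trans ?_
      gcongr
      linarith
    rw [hGe]
    calc ‖G a‖ₑ ^ 2 ≤ (ENNReal.ofReal (fourierConst V * (B * 2 ^ M)) *
        (K * energy s w ^ (1 / 2 : ℝ))) ^ 2 := by gcongr
      _ = _ := by
        rw [← mul_assoc, mul_pow _ (energy s w ^ (1 / 2 : ℝ)),
          ← ENNReal.rpow_natCast (energy s w ^ _), ← ENNReal.rpow_mul]
        norm_num
  · have h1 := isGivenBy_fourierDist_pushforward hf hθ hw hM U.orthogonalProjectionOnto
    rw [Submodule.adjoint_orthogonalProjectionOnto] at h1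
    convert h1 using 2 with η
    simp only [G, ← mul_assoc, Complex.ofReal_div, Submodule.subtypeL_apply]
    rw [div_mul_cancel₀ _ hc]

end Slice

/-! ### The orthogonal group -/

section Orthogonal

variable {d : ℕ}

/-- The action of an orthogonal matrix on `ℝ^d`. -/
def act (g : OrthGroup d) : Euc d ≃ₗᵢ[ℝ] Euc d :=
  (LinearMap.isometryOfInner (Matrix.toEuclideanLin g.1) fun x y => by
    have h := (Matrix.mem_orthogonalGroup_iff' (Fin d) ℝ).1 g.2
    have h' : Matrix.transpose g.1 * g.1 = 1 := h
    simp only [Matrix.toLpLin_apply, EuclideanSpace.inner_eq_star_dotProduct]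
    simp only [star_trivial]
    rw [Matrix.dotProduct_mulVec, ← Matrix.mulVec_transpose, Matrix.mulVec_mulVec, h',
      Matrix.one_mulVec]).toLinearIsometryEquiv rfl

theorem act_apply (g : OrthGroup d) (x : Euc d) : act g x = WithLp.toLp 2 (g.1.mulVec x.ofLp) := rfl

theorem act_mul (g h : OrthGroup d) (x : Euc d) : act (g * h) x = act g (act h x) := by
  simp [act_apply, Matrix.mulVec_mulVec]

theorem act_one (x : Euc d) : act (1 : OrthGroup d) x = x := by
  simp [act_apply]

theorem act_single (g : OrthGroup d) (j : Fin d) :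
    act g (EuclideanSpace.single j 1) = col g j := by
  ext i
  simp [act_apply, col]

theorem continuous_act : Continuous fun p : OrthGroup d × Euc d => act p.1 p.2 := by
  simp only [act_apply]
  refine (PiLp.continuous_toLp 2 _).comp ?_
  exact (continuous_subtype_val.comp continuous_fst).matrix_mulVec
    ((PiLp.continuous_ofLp 2 _).comp continuous_snd)

/-- Every orthonormal basis consists of the columns of an orthogonal matrix. -/
theorem exists_col_eq (b : OrthonormalBasis (Fin d) ℝ (Euc d)) :
    ∃ g : OrthGroup d, ∀ j, col g j = b j := by
  refine ⟨⟨Matrix.of fun i j => b j i, (Matrix.mem_orthogonalGroup_iff' (Fin d) ℝ).2 ?_⟩,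
    fun j => rfl⟩
  ext i j
  have := orthonormal_iff_ite.1 b.orthonormal i j
  rw [Matrix.mul_apply, Matrix.one_apply, ← this]
  simp [PiLp.inner_apply, mul_comm]

/-- `O(d)` acts transitively on spheres. -/
theorem exists_act_eq (i₀ : Fin d) (x : Euc d) :
    ∃ g : OrthGroup d, act g (‖x‖ • EuclideanSpace.single i₀ 1) = x := by
  rcases eq_or_ne x 0 with rfl | hx
  · exact ⟨1, by simp⟩
  have hn : ‖x‖ ≠ 0 := norm_ne_zero_iff.2 hx
  have ho : Orthonormal ℝ (({i₀} : Set (Fin d)).domRestrict fun _ : Fin d => ‖x‖⁻¹ • x) := by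
    refine ⟨fun i => ?_, fun i j hij => (hij (Subsingleton.elim i j)).elim⟩
    simp [Set.domRestrict, norm_smul, hn]
  obtain ⟨b, hb⟩ := ho.exists_orthonormalBasis_extension_of_card_eq (by simp)
  obtain ⟨g, hg⟩ := exists_col_eq b
  refine ⟨g, ?_⟩
  rw [map_smul, act_single, hg, hb i₀ rfl, smul_smul, mul_inv_cancel₀ hn, one_smul]

instance : PolishSpace (OrthGroup d) := by
  have : PolishSpace (Matrix (Fin d) (Fin d) ℝ) :=
    inferInstanceAs (PolishSpace (Fin d → Fin d → ℝ))
  have h : IsCompact ((OrthGroup d : Submonoid (Matrix (Fin d) (Fin d) ℝ)) :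
      Set (Matrix (Fin d) (Fin d) ℝ)) :=
    isCompact_iff_compactSpace.2 (inferInstanceAs (CompactSpace (OrthGroup d)))
  exact h.isClosed.polishSpace

instance : (orthHaar d).IsHaarMeasure := by
  unfold orthHaar; infer_instance

/-- Compact groups are unimodular: the right translates of the Haar probability measure are Haar
probability measures. -/
instance : (orthHaar d).IsMulRightInvariant where
  map_mul_right_eq_self g := by
    have : IsProbabilityMeasure ((orthHaar d).map (· * g)) :=
      Measure.isProbabilityMeasure_map (measurable_mul_const g).aemeasurable
    exact Measure.isHaarMeasure_eq_of_isProbabilityMeasure _ _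

end Orthogonal

/-! ### Integration over the Grassmannian -/

section Polar

variable {E : Type*} [NormedAddCommGroup E] [InnerProductSpace ℝ E] [FiniteDimensional ℝ E]
  [MeasurableSpace E] [BorelSpace E]

/-- Integration of a radial function in polar coordinates. -/
theorem lintegral_radial [Nontrivial E] {h : ℝ → ℝ≥0∞} (hh : Measurable h) :
    ∫⁻ x : E, h ‖x‖ = (volume : Measure E).toSphere Set.univ *
      ∫⁻ r in Set.Ioi (0 : ℝ), ENNReal.ofReal (r ^ (Module.finrank ℝ E - 1)) * h r := by
  calc ∫⁻ x : E, h ‖x‖ = ∫⁻ x : ({(0 : E)}ᶜ : Set E), h ‖x.1‖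
        ∂((volume : Measure E).comap Subtype.val) := by
        rw [lintegral_subtype_comap (measurableSet_singleton (0 : E)).compl fun x => h ‖x‖,
          restrict_compl_singleton]
    _ = ∫⁻ p : Metric.sphere (0 : E) 1 × Set.Ioi (0 : ℝ), h p.2
          ∂((volume : Measure E).toSphere.prod (.volumeIoiPow (Module.finrank ℝ E - 1))) := by
        have := (volume : Measure E).measurePreserving_homeomorphUnitSphereProd.lintegral_comp
          (f := fun p => h p.2) (by fun_prop)
        simpa using this
    _ = _ := by
        rw [lintegral_prod _ (by fun_prop)]
        simp only [lintegral_const]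
        rw [mul_comm, Measure.volumeIoiPow, lintegral_withDensity_eq_lintegral_mul _ (by fun_prop)
          (by fun_prop)]
        congr 1
        exact lintegral_subtype_comap measurableSet_Ioi
          fun r => ENNReal.ofReal (r ^ (Module.finrank ℝ E - 1)) * h r

theorem toSphere_univ_ne_zero [Nontrivial E] :
    (volume : Measure E).toSphere Set.univ ≠ 0 := by
  rw [Measure.toSphere_apply_univ]
  exact mul_ne_zero (by exact_mod_cast Module.finrank_pos.ne')
    (Metric.measure_ball_pos _ _ one_pos).ne'

theorem toSphere_univ_ne_top : (volume : Measure E).toSphere Set.univ ≠ ⊤ := by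
  rw [Measure.toSphere_apply_univ]
  exact ENNReal.mul_ne_top (ENNReal.natCast_ne_top _) measure_ball_lt_top.ne

end Polar

section Grassmannian

variable {k d : ℕ}

theorem Grassmannian.proj_injective : Function.Injective (Grassmannian.proj (k := k) (d := d)) := by
  rintro ⟨U, hU⟩ ⟨U', hU'⟩ h
  obtain rfl : U = U' := Submodule.starProjection_inj.1 h
  rfl

instance : SecondCountableTopology (Grassmannian k d) :=
  (Topology.IsInducing.mk rfl : Topology.IsInducing
    (Grassmannian.proj (k := k) (d := d))).secondCountableTopology

instance : T2Space (Grassmannian k d) :=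
  T2Space.of_injective_continuous Grassmannian.proj_injective continuous_induced_dom

/-- `O(d)` acts transitively on the Grassmannian: extend an orthonormal basis of `α` to `ℝ^d`. -/
theorem rotated_surjective (hk : k ≤ d) : Function.Surjective (rotated (d := d) hk) := by
  rintro ⟨U, hU⟩
  let b : OrthonormalBasis (Fin k) ℝ U := (stdOrthonormalBasis ℝ U).reindex (finCongr hU)
  let v : Fin d → Euc d := fun i => if h : (i : ℕ) < k then (b ⟨i, h⟩ : Euc d) else 0
  have ho : Orthonormal ℝ ({i : Fin d | (i : ℕ) < k}.domRestrict v) := by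
    have h1 : Orthonormal ℝ fun i : Fin k => (b i : Euc d) :=
      b.orthonormal.comp_linearIsometry U.subtypeₗᵢ
    have h2 := h1.comp (fun i : {i : Fin d | (i : ℕ) < k} => (⟨i.1, i.2⟩ : Fin k))
      (fun i j hij => Subtype.ext (Fin.ext (by simpa using hij)))
    convert h2 using 1
    ext1 i
    have hi : ((i : Fin d) : ℕ) < k := i.2
    simp [v, Set.domRestrict, hi]
  obtain ⟨b', hb'⟩ := ho.exists_orthonormalBasis_extension_of_card_eq (by simp)
  obtain ⟨g, hg⟩ := exists_col_eq b'
  have hcol : ∀ i : Fin k, col g (Fin.castLE hk i) = b i := fun i => by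
    rw [hg, hb' _ (by simp)]
    simp [v]
  refine ⟨g, ?_⟩
  have : (rotated hk g).space = U := by
    have h3 := congrArg (Submodule.map U.subtype) b.toBasis.span_eq
    rw [Submodule.map_span, Submodule.map_top, Submodule.range_subtype, ← Set.range_comp] at h3
    simp only [rotated, hcol]
    exact h3
  cases hr : rotated hk g with
  | mk U' h' =>
    rw [hr] at this
    subst this
    rfl

theorem rotated_space_eq_map (hk : k ≤ d) (g : OrthGroup d) :
    (rotated hk g).space = (rotated hk 1).space.map (act g).toLinearEquiv.toLinearMap := by
  simp only [rotated]
  rw [Submodule.map_span, ← Set.range_comp]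
  congr 2
  ext1 i
  simp [← act_single, act_one]

/-- Integrals over `(g α₀)ᗮ` are pulled back to the fixed space `α₀ᗮ`. -/
theorem lintegral_rotated (hk : k ≤ d) (A : OrthGroup d) {g : Euc d → ℝ≥0∞} (hg : Measurable g) :
    ∫⁻ η : (rotated hk A).spaceᗮ, g η = ∫⁻ η : (rotated hk 1).spaceᗮ, g (act A η) := by
  have h : (rotated hk A).spaceᗮ = (rotated hk 1).spaceᗮ.map (act A).toLinearEquiv.toLinearMap := by
    rw [rotated_space_eq_map hk A, ← Submodule.map_orthogonal_equiv]
  rw [h]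
  exact (((act A).submoduleMap (rotated hk 1).spaceᗮ).measurePreserving.lintegral_comp
    (f := fun η => g η) (by fun_prop)).symm

theorem measurable_act : Measurable fun p : OrthGroup d × Euc d => act p.1 p.2 :=
  continuous_act.measurable

theorem measurable_comp_act {X : Type*} [MeasurableSpace X] {g : Euc d → ℝ≥0∞}
    (hg : Measurable g) {A : X → OrthGroup d} (hA : Measurable A) {v : X → Euc d}
    (hv : Measurable v) : Measurable fun p => g (act (A p) (v p)) := by
  have h := hg.comp (measurable_act.comp (hA.prodMk hv))
  exact h

/-- Measurability can be checked on `O(d)`, as `O(d) → G_{k,d}` is a continuous surjection from a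
Polish space. -/
theorem measurable_lintegral_orthogonal (hk : k ≤ d) {g : Euc d → ℝ≥0∞} (hg : Measurable g) :
    Measurable fun α : Grassmannian k d => ∫⁻ η : α.spaceᗮ, g η := by
  rw [← (continuous_rotated hk).measurable.measurable_comp_iff_of_surjective
    (rotated_surjective hk)]
  simp only [Function.comp_def, lintegral_rotated hk _ hg]
  exact (measurable_comp_act hg measurable_fst
    (measurable_subtype_coe.comp measurable_snd)).lintegral_prod_right'

/-- The integral over all `αᗮ` as the integral of the rotation average over one fixed `α₀ᗮ`. -/
theorem lintegral_grassmannian (hk : k ≤ d) {g : Euc d → ℝ≥0∞} (hg : Measurable g) :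
    ∫⁻ α : Grassmannian k d, (∫⁻ η : α.spaceᗮ, g η) ∂(grassmannianMeasure k d) =
      grassmannianMass k d *
        ∫⁻ η : (rotated (d := d) hk 1).spaceᗮ, ∫⁻ A, g (act A η) ∂(orthHaar d) := by
  rw [grassmannianMeasure, dif_pos hk, lintegral_smul_measure, smul_eq_mul,
    lintegral_map (measurable_lintegral_orthogonal hk hg) (continuous_rotated hk).measurable]
  simp only [lintegral_rotated hk _ hg]
  congr 1
  exact lintegral_lintegral_swap (measurable_comp_act hg measurable_fst
    (measurable_subtype_coe.comp measurable_snd)).aemeasurable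

theorem grassmannianMass_ne_zero : grassmannianMass k d ≠ 0 := by
  refine (ENNReal.div_pos ?_ ?_).ne'
  · exact Finset.prod_ne_zero_iff.2 fun j _ => toSphere_univ_ne_zero
  · exact (ENNReal.prod_lt_top fun j _ => toSphere_univ_ne_top.lt_top).ne

theorem grassmannianMass_ne_top : grassmannianMass k d ≠ ⊤ := by
  refine ENNReal.div_ne_top ?_ ?_
  · exact (ENNReal.prod_lt_top fun j _ => toSphere_univ_ne_top.lt_top).ne
  · exact Finset.prod_ne_zero_iff.2 fun j _ => toSphere_univ_ne_zero

/-- The average of a function over `O(d)` is radial. -/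
theorem lintegral_act_eq (g : Euc d → ℝ≥0∞) (i₀ : Fin d) (x : Euc d) :
    ∫⁻ A, g (act A x) ∂(orthHaar d) =
      ∫⁻ A, g (act A (‖x‖ • EuclideanSpace.single i₀ 1)) ∂(orthHaar d) := by
  obtain ⟨B, hB⟩ := exists_act_eq i₀ x
  have h := lintegral_mul_right_eq_self (μ := orthHaar d)
    (fun A => g (act A (‖x‖ • EuclideanSpace.single i₀ 1))) B
  simp only [act_mul, hB] at h
  exact h

/-- Averaging over rotations in an integral with a radial weight. -/
theorem lintegral_mul_radial {g : Euc d → ℝ≥0∞} (hg : Measurable g) {ρ : ℝ → ℝ≥0∞}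
    (hρ : Measurable ρ) :
    ∫⁻ x, ρ ‖x‖ * g x = ∫⁻ x, ρ ‖x‖ * ∫⁻ A, g (act A x) ∂(orthHaar d) := by
  have h1 : ∀ A : OrthGroup d, ∫⁻ x, ρ ‖x‖ * g (act A x) = ∫⁻ x, ρ ‖x‖ * g x := fun A => by
    have := (act A).measurePreserving.lintegral_comp (f := fun x => ρ ‖x‖ * g x) (by fun_prop)
    simpa only [LinearIsometryEquiv.norm_map] using this
  have hm : Measurable fun p : OrthGroup d × Euc d => g (act p.1 p.2) :=
    measurable_comp_act hg measurable_fst measurable_snd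
  calc ∫⁻ x, ρ ‖x‖ * g x = ∫⁻ _A : OrthGroup d, ∫⁻ x, ρ ‖x‖ * g x ∂volume ∂(orthHaar d) := by
        simp
    _ = ∫⁻ A : OrthGroup d, ∫⁻ x, ρ ‖x‖ * g (act A x) ∂volume ∂(orthHaar d) := by
        simp only [h1]
    _ = ∫⁻ x, ∫⁻ A : OrthGroup d, ρ ‖x‖ * g (act A x) ∂(orthHaar d) := by
        refine lintegral_lintegral_swap (Measurable.aemeasurable ?_)
        exact Measurable.mul (by fun_prop) hm
    _ = _ := by
        refine lintegral_congr fun x => ?_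
        exact lintegral_const_mul _ (measurable_comp_act hg measurable_id measurable_const)

/-- The integral over all orthogonal complements of `k`-planes is, up to a constant, the integral
against the weight `|x|^(-k)`. -/
theorem exists_lintegral_grassmannian_eq (hkd : k < d) : ∃ κ : ℝ≥0∞, κ ≠ 0 ∧ κ ≠ ⊤ ∧
    ∀ g : Euc d → ℝ≥0∞, Measurable g →
      ∫⁻ α : Grassmannian k d, (∫⁻ η : α.spaceᗮ, g η) ∂(grassmannianMeasure k d) =
        κ * ∫⁻ x, ENNReal.ofReal ((‖x‖ ^ k)⁻¹) * g x := by
  have hk := hkd.le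
  let i₀ : Fin d := ⟨0, by omega⟩
  let W := (rotated (d := d) hk 1).spaceᗮ
  have hW : Module.finrank ℝ W = d - k := by
    have h1 := (rotated (d := d) hk 1).space.finrank_add_finrank_orthogonal
    rw [(rotated (d := d) hk 1).finrank_eq, finrank_euclideanSpace_fin] at h1
    change Module.finrank ℝ (rotated (d := d) hk 1).spaceᗮ = d - k
    omega
  have : Nontrivial W := Module.nontrivial_of_finrank_pos (R := ℝ) (by omega)
  have : Nontrivial (Euc d) := Module.nontrivial_of_finrank_pos (R := ℝ) (by simp; omega)
  -- The constant is the mass of the Grassmannian times `|S^(d-k-1)| / |S^(d-1)|`.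
  set S := (volume : Measure (Euc d)).toSphere Set.univ
  set S' := (volume : Measure W).toSphere Set.univ
  have hS0 : S ≠ 0 := toSphere_univ_ne_zero
  have hS : S ≠ ⊤ := toSphere_univ_ne_top
  have hS0' : S' ≠ 0 := toSphere_univ_ne_zero
  have hS' : S' ≠ ⊤ := toSphere_univ_ne_top
  refine ⟨grassmannianMass k d * (S' / S),
    mul_ne_zero grassmannianMass_ne_zero (ENNReal.div_pos hS0' hS).ne',
    ENNReal.mul_ne_top grassmannianMass_ne_top (ENNReal.div_ne_top hS' hS0), fun g hg => ?_⟩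
  let H : ℝ → ℝ≥0∞ := fun r => ∫⁻ A, g (act A (r • EuclideanSpace.single i₀ 1)) ∂(orthHaar d)
  have hH : Measurable H :=
    (measurable_comp_act hg measurable_snd
      (measurable_fst.smul_const (EuclideanSpace.single i₀ (1 : ℝ)))).lintegral_prod_right'
  have h1 : ∫⁻ η : W, ∫⁻ A, g (act A η) ∂(orthHaar d) =
      S' * ∫⁻ r in Set.Ioi (0 : ℝ), ENNReal.ofReal (r ^ (d - k - 1)) * H r := by
    rw [← hW, ← lintegral_radial hH]
    refine lintegral_congr fun η => ?_
    rw [lintegral_act_eq g i₀]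
    rfl
  have h2 : ∫⁻ x, ENNReal.ofReal ((‖x‖ ^ k)⁻¹) * g x =
      S * ∫⁻ r in Set.Ioi (0 : ℝ), ENNReal.ofReal (r ^ (d - k - 1)) * H r := by
    have hρ : Measurable fun r : ℝ => ENNReal.ofReal ((r ^ k)⁻¹) := by fun_prop
    rw [lintegral_mul_radial hg hρ]
    have h3 : ∀ x : Euc d, ENNReal.ofReal ((‖x‖ ^ k)⁻¹) * ∫⁻ A, g (act A x) ∂(orthHaar d) =
        (fun r : ℝ => ENNReal.ofReal ((r ^ k)⁻¹) * H r) ‖x‖ := fun x => by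
      rw [lintegral_act_eq g i₀]
    simp only [h3]
    rw [lintegral_radial (h := fun r : ℝ => ENNReal.ofReal ((r ^ k)⁻¹) * H r) (hρ.mul hH)]
    congr 1
    refine setLIntegral_congr_fun measurableSet_Ioi fun r hr => ?_
    have hr' : (0 : ℝ) < r := hr
    simp only [← mul_assoc]
    rw [← ENNReal.ofReal_mul (by positivity), finrank_euclideanSpace_fin]
    congr 2
    rw [← div_eq_mul_inv, div_eq_iff (by positivity), ← pow_add]
    congr 1
    omega
  rw [lintegral_grassmannian hk hg, h1, h2, mul_assoc, ← mul_assoc (S' / S),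
    ENNReal.div_mul_cancel hS0 hS]

end Grassmannian

/-! ### Sobolev norms on the affine Grassmannian -/

variable {k d : ℕ}

theorem HasFiberFourier.sobolevNormG_eq {s : ℝ} {u : FiberDistribution k d}
    {w : AffineGrassmannian k d → ℂ} (h : HasFiberFourier u w) :
    sobolevNormG s u =
      (∫⁻ α, energy s (fun η : α.spaceᗮ => w ⟨α, η⟩) ∂(grassmannianMeasure k d)) ^ (1 / 2 : ℝ) := by
  refine le_antisymm (iInf₂_le w h) (le_iInf₂ fun w' h' => le_of_eq ?_)
  congr 1
  refine lintegral_congr_ae ?_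
  filter_upwards [h.2, h'.2] with α h1 h2
  exact energy_congr (h1.ae_eq h2)

theorem measurable_comp_pt {G : Euc d → ℂ} (hG : Measurable G) :
    Measurable fun p : AffineGrassmannian k d => G p.pt :=
  hG.comp (measurable_snd.comp (comap_measurable _))

/-- The ratio `(2π)^(k/2)` of the normalizing factors of the Fourier transforms on `αᗮ` and `ℝ^d`
(for `k ≤ d`). -/
def sliceConst (k d : ℕ) : ℝ :=
  (2 * Real.pi) ^ (-((d - k : ℕ) : ℝ) / 2) / fourierConst (Euc d)

theorem sliceConst_pos : 0 < sliceConst k d :=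
  div_pos (by positivity) fourierConst_pos

theorem fourierConst_orthogonal_div (α : Grassmannian k d) :
    fourierConst α.spaceᗮ / fourierConst (Euc d) = sliceConst k d := by
  have h : Module.finrank ℝ α.spaceᗮ = d - k := by
    have h1 := α.space.finrank_add_finrank_orthogonal
    rw [α.finrank_eq, finrank_euclideanSpace_fin] at h1
    omega
  rw [sliceConst]
  congr 1
  rw [fourierConst, h]

theorem energy_const_mul {V : Type*} [NormedAddCommGroup V] [InnerProductSpace ℝ V]
    [FiniteDimensional ℝ V] [MeasurableSpace V] [BorelSpace V] (s : ℝ) {a : ℝ} (ha : 0 ≤ a)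
    (w : V → ℂ) : energy s (fun η => (a : ℂ) * w η) = ENNReal.ofReal (a ^ 2) * energy s w := by
  rw [energy, energy, ← lintegral_const_mul' _ _ ENNReal.ofReal_ne_top]
  refine lintegral_congr fun η => ?_
  rw [enorm_mul, mul_pow, ← ofReal_norm (a : ℂ), Complex.norm_real, Real.norm_of_nonneg ha,
    ENNReal.ofReal_pow ha, mul_left_comm]

/-- If every slice of `û` is the restriction of one function `G`, up to `sliceConst`, then the norm
of `u` is an integral over `ℝ^d` with the weight `|x|^(-k)` of `exists_lintegral_grassmannian_eq`. -/
theorem sobolevNormG_eq_of_slices {κ : ℝ≥0∞} (hκ : ∀ g : Euc d → ℝ≥0∞, Measurable g →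
      ∫⁻ α : Grassmannian k d, (∫⁻ η : α.spaceᗮ, g η) ∂(grassmannianMeasure k d) =
        κ * ∫⁻ x, ENNReal.ofReal ((‖x‖ ^ k)⁻¹) * g x)
    {u : FiberDistribution k d} {G : Euc d → ℂ} (hG : Measurable G)
    (h : ∀ α : Grassmannian k d, IsGivenBy (fourierDist (u α))
      (fun η : α.spaceᗮ => (sliceConst k d : ℂ) * G η)) (r : ℝ) :
    sobolevNormG r u = (ENNReal.ofReal (sliceConst k d ^ 2) * (κ * ∫⁻ x,
      ENNReal.ofReal ((‖x‖ ^ k)⁻¹) * (ENNReal.ofReal ((1 + ‖x‖ ^ 2) ^ r) * ‖G x‖ₑ ^ 2))) ^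
        (1 / 2 : ℝ) := by
  have hF : HasFiberFourier u fun p => (sliceConst k d : ℂ) * G p.pt :=
    ⟨(measurable_comp_pt hG).const_mul _, Filter.Eventually.of_forall fun α => h α⟩
  rw [hF.sobolevNormG_eq]
  simp only [energy_const_mul r (sliceConst_pos (k := k) (d := d)).le]
  rw [lintegral_const_mul' _ _ ENNReal.ofReal_ne_top, ← hκ _ (by fun_prop)]
  rfl

/-- Lower bound: `|x|^k ≤ (1 + |x|²)^(k/2)`. -/
theorem energy_le_lintegral_weight (hd : 0 < d) (s : ℝ) (G : Euc d → ℂ) :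
    energy s G ≤ ∫⁻ x, ENNReal.ofReal ((‖x‖ ^ k)⁻¹) *
      (ENNReal.ofReal ((1 + ‖x‖ ^ 2) ^ (s + k / 2)) * ‖G x‖ₑ ^ 2) := by
  have : Nontrivial (Euc d) := Module.nontrivial_of_finrank_pos (R := ℝ) (by simpa using hd)
  refine lintegral_mono_ae ?_
  filter_upwards [Measure.ae_ne volume (0 : Euc d)] with x hx
  have hx' : 0 < ‖x‖ := norm_pos_iff.2 hx
  rw [← mul_assoc, ← ENNReal.ofReal_mul (by positivity)]
  gcongr
  rw [inv_mul_eq_div, le_div_iff₀ (by positivity), Real.rpow_add (by positivity)]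
  gcongr
  calc ‖x‖ ^ k = (‖x‖ ^ 2) ^ ((k : ℝ) / 2) := by
        rw [← Real.rpow_natCast, ← Real.rpow_natCast, ← Real.rpow_mul hx'.le]
        congr 1
        push_cast
        ring
    _ ≤ _ := by gcongr; linarith

/-- Upper bound, pointwise: the singular weight is harmless for `|x| > 1`, and for `|x| ≤ 1` the
function `G` is bounded. -/
theorem weight_mul_le {s : ℝ} {G : Euc d → ℂ} {b : ℝ≥0∞} (hb : ∀ a, ‖a‖ ≤ 1 → ‖G a‖ₑ ^ 2 ≤ b)
    (x : Euc d) :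
    ENNReal.ofReal ((‖x‖ ^ k)⁻¹) * (ENNReal.ofReal ((1 + ‖x‖ ^ 2) ^ (s + k / 2)) * ‖G x‖ₑ ^ 2) ≤
      ENNReal.ofReal (2 ^ |s + k / 2|) * b *
          (ENNReal.ofReal ((‖x‖ ^ k)⁻¹) * (Metric.closedBall (0 : Euc d) 1).indicator 1 x) +
        ENNReal.ofReal (2 ^ ((k : ℝ) / 2)) * (ENNReal.ofReal ((1 + ‖x‖ ^ 2) ^ s) * ‖G x‖ₑ ^ 2) := by
  rcases le_or_gt ‖x‖ 1 with hx | hx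
  · refine le_add_right ?_
    rw [Set.indicator_of_mem (by simpa using hx), Pi.one_apply, mul_one, mul_comm]
    gcongr ENNReal.ofReal ?_ * ?_ * _
    · calc (1 + ‖x‖ ^ 2) ^ (s + k / 2) ≤ (1 + ‖x‖ ^ 2) ^ |s + k / 2| :=
            Real.rpow_le_rpow_of_exponent_le (by nlinarith [norm_nonneg x]) (le_abs_self _)
        _ ≤ 2 ^ |s + k / 2| := by
            refine Real.rpow_le_rpow (by positivity) ?_ (abs_nonneg _)
            nlinarith [norm_nonneg x]
    · exact hb x hx
  · refine le_add_left ?_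
    rw [← mul_assoc, ← mul_assoc, ← ENNReal.ofReal_mul (by positivity),
      ← ENNReal.ofReal_mul (by positivity)]
    gcongr ENNReal.ofReal ?_ * _
    rw [inv_mul_eq_div, div_le_iff₀ (by positivity), Real.rpow_add (by positivity)]
    calc (1 + ‖x‖ ^ 2) ^ s * (1 + ‖x‖ ^ 2) ^ ((k : ℝ) / 2)
        ≤ (1 + ‖x‖ ^ 2) ^ s * (2 * ‖x‖ ^ 2) ^ ((k : ℝ) / 2) := by
          gcongr
          nlinarith
      _ = 2 ^ ((k : ℝ) / 2) * (1 + ‖x‖ ^ 2) ^ s * ‖x‖ ^ k := by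
          rw [Real.mul_rpow (by positivity) (by positivity), ← Real.rpow_natCast ‖x‖ 2,
            ← Real.rpow_mul (by positivity), ← Real.rpow_natCast ‖x‖ k]
          have : ((2 : ℕ) : ℝ) * ((k : ℝ) / 2) = k := by push_cast; ring
          rw [this]
          ring

/-- Since `k < d`, the weight `|x|^(-k)` is integrable at the origin: up to a constant, its integral
over the unit ball is the total volume of the unit balls of the spaces `αᗮ`. -/
theorem lintegral_weight_closedBall_lt_top (hk : k ≤ d) {κ : ℝ≥0∞}
    (hκ : ∀ g : Euc d → ℝ≥0∞, Measurable g →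
      ∫⁻ α : Grassmannian k d, (∫⁻ η : α.spaceᗮ, g η) ∂(grassmannianMeasure k d) =
        κ * ∫⁻ x, ENNReal.ofReal ((‖x‖ ^ k)⁻¹) * g x) :
    κ * ∫⁻ x, ENNReal.ofReal ((‖x‖ ^ k)⁻¹) *
      (Metric.closedBall (0 : Euc d) 1).indicator 1 x < ⊤ := by
  have hm : Measurable ((Metric.closedBall (0 : Euc d) 1).indicator (1 : Euc d → ℝ≥0∞)) :=
    measurable_one.indicator Metric.isClosed_closedBall.measurableSet
  rw [← hκ _ hm, lintegral_grassmannian hk hm]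
  refine ENNReal.mul_lt_top grassmannianMass_ne_top.lt_top ?_
  have e : ∀ η : (rotated (d := d) hk 1).spaceᗮ,
      ∫⁻ A, (Metric.closedBall (0 : Euc d) 1).indicator 1 (act A η) ∂(orthHaar d) =
        (Metric.closedBall (0 : (rotated (d := d) hk 1).spaceᗮ) 1).indicator 1 η := fun η => by
    have h : ∀ A : OrthGroup d,
        (Metric.closedBall (0 : Euc d) 1).indicator (1 : Euc d → ℝ≥0∞) (act A η) =
          (Metric.closedBall (0 : (rotated (d := d) hk 1).spaceᗮ) 1).indicator 1 η := fun A => by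
      refine Set.indicator_eq_indicator ?_ rfl
      rw [mem_closedBall_zero_iff, mem_closedBall_zero_iff, LinearIsometryEquiv.norm_map,
        Submodule.coe_norm]
    rw [lintegral_congr h, lintegral_const, measure_univ, mul_one]
  rw [lintegral_congr e, lintegral_indicator_one Metric.isClosed_closedBall.measurableSet]
  exact measure_closedBall_lt_top

theorem ofReal_toReal_rpow_mul_le {L E T : ℝ≥0∞} (hL : L ≠ ⊤) (h : L * E ≤ T) :
    ENNReal.ofReal (L ^ (1 / 2 : ℝ)).toReal * E ^ (1 / 2 : ℝ) ≤ T ^ (1 / 2 : ℝ) := by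
  rw [ENNReal.ofReal_toReal (ENNReal.rpow_ne_top_of_nonneg (by norm_num) hL),
    ← ENNReal.mul_rpow_of_nonneg _ _ (by norm_num)]
  exact ENNReal.rpow_le_rpow h (by norm_num)

end KPlane

end

theorem theorem4p1 (d k : ℕ) (hd : 2 ≤ d) (hk : 1 ≤ k) (hkd : k ≤ d - 1) (s : ℝ) :
    ∃ c : ℝ, 0 < c ∧
      ∀ Ω : Set (KPlane.Euc d), IsOpen Ω → Bornology.IsBounded Ω →
        ∃ C : ℝ, 0 < C ∧
          ∀ f : 𝓢'(KPlane.Euc d, ℂ), TemperedDistribution.MemSobolev s 2 f →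
            Distribution.dsupport f ⊆ closure Ω →
            KPlane.MemSobolevG (s + k / 2) (KPlane.distTransform k f) ∧
            ENNReal.ofReal c * KPlane.sobolevNorm s f ≤
              KPlane.sobolevNormG (s + k / 2) (KPlane.distTransform k f) ∧
            KPlane.sobolevNormG (s + k / 2) (KPlane.distTransform k f) ≤
              ENNReal.ofReal C * KPlane.sobolevNorm s f := by
  open KPlane in
  obtain ⟨κ, hκ0, hκ, hκg⟩ := exists_lintegral_grassmannian_eq (k := k) (d := d) (by omega)
  set β : ℝ≥0∞ := ENNReal.ofReal (sliceConst k d ^ 2) with hβ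
  have hβ0 : β ≠ 0 := by
    have := sliceConst_pos (k := k) (d := d)
    exact (ENNReal.ofReal_pos.2 (by positivity)).ne'
  have hβκ : β * κ ≠ ⊤ := ENNReal.mul_ne_top ENNReal.ofReal_ne_top hκ
  refine ⟨((β * κ) ^ (1 / 2 : ℝ)).toReal, ENNReal.toReal_pos
    (ENNReal.rpow_pos (pos_iff_ne_zero.2 (mul_ne_zero hβ0 hκ0)) hβκ).ne'
    (ENNReal.rpow_ne_top_of_nonneg (by norm_num) hβκ), fun Ω _ hΩ => ?_⟩
  obtain ⟨χ, hχ, -, U, hU, hΩU, hU1⟩ := exists_cutoff hΩ.isCompact_closure isOpen_univ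
    (Set.subset_univ _)
  obtain ⟨B, hB, hBf⟩ := exists_fourier_representative χ s
  set J := κ * ∫⁻ x : Euc d, ENNReal.ofReal ((‖x‖ ^ k)⁻¹) *
      (Metric.closedBall (0 : Euc d) 1).indicator 1 x with hJ
  have hJt : J < ⊤ := lintegral_weight_closedBall_lt_top (by omega) hκg
  -- `Q` and `β * κ` are the two constants for the squares of the norms.
  set Q : ℝ≥0∞ := β * (ENNReal.ofReal (2 ^ |s + k / 2|) * B * J +
    κ * ENNReal.ofReal (2 ^ ((k : ℝ) / 2))) with hQ
  have hQt : Q ≠ ⊤ := ENNReal.mul_ne_top ENNReal.ofReal_ne_top (ENNReal.add_ne_top.2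
    ⟨ENNReal.mul_ne_top (ENNReal.mul_ne_top ENNReal.ofReal_ne_top hB) hJt.ne,
      ENNReal.mul_ne_top hκ ENNReal.ofReal_ne_top⟩)
  refine ⟨(Q ^ (1 / 2 : ℝ)).toReal + 1, by positivity, fun f hf hfΩ => ?_⟩
  obtain ⟨G, hGm, hG, hGe, hGb, hGU⟩ := hBf f ⟨hχ, U, hU, hfΩ.trans hΩU, hU1⟩ hf
  have hslice : ∀ α : Grassmannian k d, IsGivenBy (fourierDist (distTransform k f α))
      (fun η : α.spaceᗮ => (sliceConst k d : ℂ) * G η) := fun α => by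
    rw [← fourierConst_orthogonal_div α]
    exact hGU α.spaceᗮ
  rw [MemSobolevG, sobolevNormG_eq_of_slices hκg hGm hslice, sobolevNorm_eq hG]
  set I := ∫⁻ x, ENNReal.ofReal ((‖x‖ ^ k)⁻¹) *
    (ENNReal.ofReal ((1 + ‖x‖ ^ 2) ^ (s + k / 2)) * ‖G x‖ₑ ^ 2)
  have hI : κ * I ≤ (ENNReal.ofReal (2 ^ |s + k / 2|) * B * J +
      κ * ENNReal.ofReal (2 ^ ((k : ℝ) / 2))) * energy s G := by
    have hm : Measurable ((Metric.closedBall (0 : Euc d) 1).indicator (1 : Euc d → ℝ≥0∞)) :=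
      measurable_one.indicator Metric.isClosed_closedBall.measurableSet
    have h1 := lintegral_mono (μ := volume) fun x => weight_mul_le (k := k) (s := s) hGb x
    rw [lintegral_add_left (by fun_prop), lintegral_const_mul _ (by fun_prop),
      lintegral_const_mul' _ _ ENNReal.ofReal_ne_top] at h1
    refine (mul_le_mul_right h1 κ).trans_eq ?_
    change κ * (_ + _ * energy s G) = _
    rw [hJ]
    ring
  have hT : β * (κ * I) ≤ Q * energy s G := by
    rw [hQ, mul_assoc]
    gcongr
  refine ⟨?_, ?_, ?_⟩
  · exact ENNReal.rpow_lt_top_of_nonneg (by norm_num)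
      (hT.trans_lt (ENNReal.mul_lt_top hQt.lt_top hGe)).ne
  · refine ofReal_toReal_rpow_mul_le hβκ ?_
    rw [mul_assoc]
    gcongr
    exact energy_le_lintegral_weight (by omega) s G
  · calc _ ≤ (Q * energy s G) ^ (1 / 2 : ℝ) := ENNReal.rpow_le_rpow hT (by norm_num)
      _ = Q ^ (1 / 2 : ℝ) * energy s G ^ (1 / 2 : ℝ) :=
          ENNReal.mul_rpow_of_nonneg _ _ (by norm_num)
      _ ≤ _ := by
          gcongr
          exact (ENNReal.le_ofReal_iff_toReal_le
            (ENNReal.rpow_ne_top_of_nonneg (by norm_num) hQt) (by positivity)).2 (by linarith)
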